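/- There is an absolute constant $C_0>0$ such that the following holds. **Setting.** Let $d\ge 0$, $1\le K\le N$ be integers and let $B_1,\dots,B_K$ be a partition of $[N]=\{1,\dots,N\}$ into $K$ blocks of equal size $N/K$. Let $\tilde X_1,\dots,\tilde X_N$ be i.i.d. random vectors in $\mathbb R^d$ (the inliers; no moment is assumed). An adversary, who may look at all the $\tilde X_i$, modifies at most $|\mathcal O|$ of them in an arbitrary way, and the statistician observes the resulting vectors $X_1,\dots,X_N$: there is a set $\mathcal O$ of at most $|\mathcal O|$ indices, which may depend arbitrarily on the data, such that $X_i=\tilde X_i$ for all $i\notin\mathcal O$ (here $|\mathcal O|$ denotes a deterministic bound). Let $S\subset\mathbb R^d$ be symmetric ($v\in S\Rightarrow -v\in S$), $\|x\|_S=\sup_{v\in S}\langle v,x\rangle$, $\bar X_k=|B_k|^{-1}\sum_{i\in B_k}X_i$, $g(v)={\rm Med}(\langle\bar X_k,v\rangle:k\in[K])$ (the empirical median: the order statistic of rank $(K+1)/2$ if $K$ is odd, the mean of the two middle order statistics if $K$ is even), and $g_S^*(\mu)=\sup_{v\in S}(\langle\mu,v\rangle-g(v))$; these suprema are taken in $[-\infty,+\infty]$.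 Let $\hat\mu_S^g\in{\rm argmin}_{\mu\in\mathbb R^d}\,g_S^*(\mu)$. **Bound.** Assume that $\mu^*\in\mathbb R^d$ and $c_0,c_1>0$ are such that for all $v\in S$ and all $0<r\le c_0$, $$\mathbb P\Big[\frac1{\sqrt{N/K}}\sum_{i=1}^{N/K}\langle\tilde X_i-\mu^*,v\rangle>r\Big]\le\frac12-c_1r .$$ Let $u>0$ and assume that $$C_0\Big(\sqrt{\tfrac{d+1}{K}}+\sqrt{\tfrac uK}\Big)+\frac{|\mathcal O|}{K}\le c_0c_1 .$$ Then, with probability at least $1-e^{-u}$, every minimizer $\hat\mu_S^g$ of $g_S^*$ satisfies $\|\hat\mu_S^g-\mu^*\|_S\le 2r^\diamond$, where $$r^\diamond=\frac{C_0}{c_1}\Big(\sqrt{\tfrac{d+1}{N}}+\sqrt{\tfrac uN}\Big)+\frac{|\mathcal O|}{c_1\sqrt{KN}} .$$ **Coordinate-wise median and Cauchy location model.** If $S=\{\pm e_j:j\in[d]\}$, with $(e_j)$ the canonical basis, then the unique minimizer of $g_S^*$ is the coordinate-wise median $({\rm Med}(\langle\bar X_k,e_j\rangle))_{j\in[d]}$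 of the bucketed means. Let moreover $K=N$ and assume that, for some $\mu^*\in\mathbb R^d$, every coordinate of $\tilde X_i-\mu^*$ has the standard Cauchy distribution, with density $x\mapsto 1/(\pi(1+x^2))$ (the coordinates may be dependent). Let $u>0$ with $$C_0\Big(\sqrt{\tfrac{d+1}{N}}+\sqrt{\tfrac uN}\Big)+\frac{|\mathcal O|}{N}\le\frac1{2\pi}.$$ Then, with probability at least $1-e^{-u}$, the coordinate-wise median $\hat\mu$ of $X_1,\dots,X_N$ satisfies $$\|\hat\mu-\mu^*\|_\infty\le 2C_0\Big(\sqrt{\tfrac{d+1}{N}}+\sqrt{\tfrac uN}\Big)+\frac{2\pi|\mathcal O|}{N}.$$ -/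

import Mathlib

open MeasureTheory ProbabilityTheory

noncomputable section

namespace RobustLocation

/-- The empirical median of `a₁, …, a_K` (`K ≥ 1`). With the increasing rearrangement indexed from
`0`, this is the average of the entries of index `(K - 1) / 2` and `K / 2` (integer divisions). For
odd `K` both indices coincide, and it is the order statistic of rank `(K + 1) / 2` counted
from `1`. -/
def med {K : ℕ} [NeZero K] (a : Fin K → ℝ) : ℝ :=
  ((a ∘ Tuple.sort a) ⟨(K - 1) / 2, by have := NeZero.pos K; omega⟩ +
    (a ∘ Tuple.sort a) ⟨K / 2, by have := NeZero.pos K; omega⟩) / 2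

/-- The sets `B k`, `k ∈ [K]`, form a partition of `[N]` into blocks of equal size `N / K`
(in particular `K` divides `N`). -/
def IsEqualSizePartition {N K : ℕ} (B : Fin K → Finset (Fin N)) : Prop :=
  (∀ i, ∃! k, i ∈ B k) ∧ ∀ k, (B k).card * K = N

/-- The bucketed mean of the data `x` over the block `b`. -/
def bucketMean {d N : ℕ} (x : Fin N → EuclideanSpace ℝ (Fin d)) (b : Finset (Fin N)) :
    EuclideanSpace ℝ (Fin d) :=
  (b.card : ℝ)⁻¹ • ∑ i ∈ b, x i

/-- The function `g(v) = Med(⟨x̄_k, v⟩)` built on the points `x̄_1, …, x̄_K`. -/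
def medFun {d K : ℕ} [NeZero K] (xbar : Fin K → EuclideanSpace ℝ (Fin d))
    (v : EuclideanSpace ℝ (Fin d)) : ℝ :=
  med fun k => inner ℝ (xbar k) v

/-- The Fenchel-Legendre transform of `f` on `S`, with values in the extended reals:
`f_S^*(μ) = sup_{v ∈ S} (⟨μ, v⟩ - f v)`. -/
def fenchel {d : ℕ} (S : Set (EuclideanSpace ℝ (Fin d))) (f : EuclideanSpace ℝ (Fin d) → ℝ)
    (μ : EuclideanSpace ℝ (Fin d)) : EReal :=
  ⨆ v ∈ S, ((inner ℝ μ v - f v : ℝ) : EReal)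

/-- The pseudo-norm `‖x‖_S = sup_{v ∈ S} ⟨v, x⟩`, with values in the extended reals. -/
def pseudoNorm {d : ℕ} (S : Set (EuclideanSpace ℝ (Fin d))) (x : EuclideanSpace ℝ (Fin d)) :
    EReal :=
  ⨆ v ∈ S, ((inner ℝ v x : ℝ) : EReal)

/-- The set of all minimizers over `ℝ^d` of an extended real valued function. -/
def argmin {d : ℕ} (F : EuclideanSpace ℝ (Fin d) → EReal) : Set (EuclideanSpace ℝ (Fin d)) :=
  {μ | ∀ ν, F μ ≤ F ν}

/-- The random vectors `Y 1, …, Y N` are i.i.d. -/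
structure IsIID {Ω : Type*} [MeasurableSpace Ω] (P : Measure Ω) {d N : ℕ}
    (Y : Fin N → Ω → EuclideanSpace ℝ (Fin d)) : Prop where
  measurable : ∀ i, Measurable (Y i)
  indep : iIndepFun Y P
  identDistrib : ∀ i j, IdentDistrib (Y i) (Y j) P P

/-- `X` is obtained from `Y` by an adversary who may modify at most `o` of the `N` vectors. The set
of modified indices and the new values may depend arbitrarily on `ω`. -/
def IsCorruption {Ω : Type*} {d N : ℕ} (o : ℕ) (Y X : Fin N → Ω → EuclideanSpace ℝ (Fin d)) :
    Prop :=
  ∀ ω, ∃ O : Finset (Fin N), O.card ≤ o ∧ ∀ i, i ∉ O → X i ω = Y i ω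

/-- `H_{N,K,v}(r)`: the probability that the sum of `⟨Y i - μ, v⟩` over the first `N / K`
indices `i`, divided by `√(N / K)`, exceeds `r`. -/
def tailH {Ω : Type*} [MeasurableSpace Ω] (P : Measure Ω) {d N : ℕ}
    (Y : Fin N → Ω → EuclideanSpace ℝ (Fin d)) (μ : EuclideanSpace ℝ (Fin d)) (K : ℕ)
    (v : EuclideanSpace ℝ (Fin d)) (r : ℝ) : ℝ :=
  P.real {ω | r < 1 / √((N : ℝ) / K) *
    ∑ i ∈ Finset.univ.filter (fun i : Fin N => (i : ℕ) < N / K), inner ℝ (Y i ω - μ) v}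

/-- The regularity condition at `0` on the tails of the block sums, in the directions of `S`, with
constants `c₀` and `c₁`. -/
def IsRegularAtZero {Ω : Type*} [MeasurableSpace Ω] (P : Measure Ω) {d N : ℕ}
    (Y : Fin N → Ω → EuclideanSpace ℝ (Fin d)) (μ : EuclideanSpace ℝ (Fin d)) (K : ℕ)
    (S : Set (EuclideanSpace ℝ (Fin d))) (c₀ c₁ : ℝ) : Prop :=
  ∀ v ∈ S, ∀ r : ℝ, 0 < r → r ≤ c₀ → tailH P Y μ K v r ≤ 1 / 2 - c₁ * r

/-- The set `{± e_j : j ∈ [d]}` of the signed canonical basis vectors. -/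
def signedBasis (d : ℕ) : Set (EuclideanSpace ℝ (Fin d)) :=
  {v | ∃ j, v = EuclideanSpace.single j 1 ∨ v = -EuclideanSpace.single j 1}

/-- The coordinate-wise median of the points `x 1, …, x K`. -/
def coordMed {d K : ℕ} [NeZero K] (x : Fin K → EuclideanSpace ℝ (Fin d)) :
    EuclideanSpace ℝ (Fin d) :=
  WithLp.toLp 2 fun j => med fun k => x k j

/-- The rate `r^⋄`, with `o` the number of outliers. -/
def rate (C₀ c₁ : ℝ) (d N K o : ℕ) (u : ℝ) : ℝ :=
  C₀ / c₁ * (√(((d : ℝ) + 1) / N) + √(u / N)) + o / (c₁ * √((K : ℝ) * N))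

end RobustLocation

end

/-! A deviation bound for half-spaces at a single level drives everything. The normalized block sums
of the inliers are K i.i.d. points, and each exceeds the level r in direction v with probability at
most 1/2 - c₁r. If, uniformly over v ∈ S, the number of points above r exceeds its mean by at most
128KT, where T = √((d+1)/K) + √(u/K), then choosing r with c₁r = 129T + o/K leaves fewer than K/2
bucketed means above the level, even after the adversary spoils o blocks. So every directional
median is at most ⟨μ,v⟩ + r/√(N/K). Symmetry of S gives the matching lower bound, and a minimizer of
g_S^* loses only a factor 2 (`pseudoNorm_sub_le`).

The uniform deviation `measure_exists_hits_le` must carry no logarithm, so it rests on chaining.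
Radon's theorem bounds the VC dimension of half-spaces by d+1. Sauer–Shelah and random sampling then
bound separated families (`log_card_le_of_separated`), chaining controls random signed sums over the
traces (`card_exists_signedSum_le`), and exchanging two samples transfers this to the counts. Only
the level r is used, so no uniformity in r and no moment is needed.

The Cauchy statement is the case of blocks of size one, with c₀ = 1 and c₁ = 1/(2π). -/

noncomputable section

namespace RobustLocation

open Finset Module

/-! ### Traces of half-spaces and their VC dimension. -/

open scoped Classical in
/-- The traces on the points `w i` of the half-spaces `{x | r < ⟪x, v⟫}`, `v ∈ V`. -/
def halfspaceTraces {E ι : Type*} [NormedAddCommGroup E] [InnerProductSpace ℝ E] [Fintype ι]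
    (V : Set E) (r : ℝ) (w : ι → E) : Finset (Finset ι) :=
  {A | ∃ v ∈ V, A = ({i | r < inner ℝ (w i) v} : Finset ι)}

open scoped Classical in
/-- The preimage of the finite set `A` under `x`. -/
def trace {κ ι : Type*} [Fintype κ] (x : κ → ι) (A : Finset ι) : Finset κ := {k | x k ∈ A}

theorem mem_trace {κ ι : Type*} [Fintype κ] {x : κ → ι} {A : Finset ι} {k : κ} :
    k ∈ trace x A ↔ x k ∈ A := by
  simp [trace]

section Traces

variable {E ι : Type*} [NormedAddCommGroup E] [InnerProductSpace ℝ E] [Fintype ι]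
  {V : Set E} {r : ℝ}

open scoped Classical in
theorem mem_halfspaceTraces {w : ι → E} {A : Finset ι} :
    A ∈ halfspaceTraces V r w ↔ ∃ v ∈ V, A = ({i | r < inner ℝ (w i) v} : Finset ι) := by
  simp [halfspaceTraces]

/-- Resampling the points, possibly with repetitions, again produces half-space traces. Hence the
Sauer–Shelah bound holds on every sample, as the packing argument demands. -/
theorem halfspaceTraces_comp {κ : Type*} [Fintype κ] (w : ι → E) (x : κ → ι) {A : Finset ι}
    (hA : A ∈ halfspaceTraces V r w) :
    trace x A ∈ halfspaceTraces V r (w ∘ x) := by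
  classical
  obtain ⟨v, hv, rfl⟩ := mem_halfspaceTraces.1 hA
  exact mem_halfspaceTraces.2 ⟨v, hv, by ext; simp [mem_trace]⟩

/-- By Radon's theorem, half-spaces cannot shatter more than `finrank + 1` points. -/
theorem card_le_of_shatters [FiniteDimensional ℝ E] [DecidableEq ι] (w : ι → E) {s : Finset ι}
    (hs : (halfspaceTraces V r w).Shatters s) : #s ≤ finrank ℝ E + 1 := by
  classical
  by_contra! hlt
  -- Repeated points also count as affine dependence, so `w` need not be injective.
  have hdep : ¬ AffineIndependent ℝ (fun i : s => w i) := fun h => by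
    have h1 := h.card_le_finrank_succ
    have h2 := Submodule.finrank_le (vectorSpan ℝ (Set.range fun i : s => w i))
    simp only [Fintype.card_coe] at h1
    omega
  obtain ⟨I, p, hp1, hp2⟩ := Convex.radon_partition hdep
  obtain ⟨u, hu, hsu⟩ := hs (t := s.filter fun i => ∃ h : i ∈ s, (⟨i, h⟩ : s) ∈ I)
    (filter_subset _ _)
  obtain ⟨v, -, rfl⟩ := mem_halfspaceTraces.1 hu
  have key : ∀ i : s, r < inner ℝ (w i) v ↔ i ∈ I := fun i => by
    have := Finset.ext_iff.1 hsu i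
    simpa using this
  have hlin : IsLinearMap ℝ fun x : E => inner ℝ x v :=
    ⟨fun x y => inner_add_left x y v, fun c x => by simp [inner_smul_left]⟩
  have h1 : r < inner ℝ p v := by
    refine convexHull_min ?_ (convex_halfSpace_gt hlin r) hp1
    rintro _ ⟨i, hi, rfl⟩
    exact (key i).2 hi
  have h2 : inner ℝ p v ≤ r := by
    refine convexHull_min ?_ (convex_halfSpace_le hlin r) hp2
    rintro _ ⟨i, hi, rfl⟩
    exact not_lt.1 fun h => hi ((key i).1 h)
  exact absurd h1 (not_lt.2 h2)

theorem vcDim_halfspaceTraces_le [FiniteDimensional ℝ E] [DecidableEq ι] (w : ι → E) :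
    (halfspaceTraces V r w).vcDim ≤ finrank ℝ E + 1 :=
  Finset.sup_le fun _ hs => card_le_of_shatters w (mem_shatterer.1 hs)

end Traces

/-! ### Sauer–Shelah, packing numbers and nets. -/

/-- For t ≤ 1 one has t^D ≤ t^k when k ≤ D, so the binomial expansion of (1+t)^m dominates. Leaving
t free avoids the usual choice t = D/m and any comparison of m with D. -/
theorem sum_choose_mul_pow_le (m D : ℕ) {t : ℝ} (ht : 0 < t) (ht1 : t ≤ 1) :
    (∑ k ∈ Iic D, (m.choose k : ℝ)) * t ^ D ≤ Real.exp (t * m) := by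
  calc (∑ k ∈ Iic D, (m.choose k : ℝ)) * t ^ D
      ≤ ∑ k ∈ Iic D, t ^ k * (m.choose k : ℝ) := by
        rw [Finset.sum_mul]
        refine Finset.sum_le_sum fun k hk => ?_
        rw [mul_comm]
        gcongr ?_ * _
        exact pow_le_pow_of_le_one ht.le ht1 (Finset.mem_Iic.1 hk)
    _ ≤ ∑ k ∈ range (m + 1), t ^ k * (m.choose k : ℝ) := by
        rw [← Finset.sum_filter_add_sum_filter_not (Iic D) (fun k => k ≤ m)]
        rw [Finset.sum_eq_zero (s := (Iic D).filter fun k => ¬ k ≤ m), add_zero]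
        · refine Finset.sum_le_sum_of_subset_of_nonneg (fun k hk => ?_) fun _ _ _ => by positivity
          simp at hk ⊢
          omega
        · intro k hk
          simp at hk
          simp [Nat.choose_eq_zero_of_lt hk.2]
    _ = (t + 1) ^ m := by
        rw [add_pow]
        simp
    _ ≤ (Real.exp t) ^ m := by
        gcongr
        exact Real.add_one_le_exp t
    _ = Real.exp (t * m) := by rw [← Real.exp_nat_mul, mul_comm]

/-- A form of the Sauer–Shelah bound. -/
theorem card_mul_pow_vcDim_le {ι : Type*} [Fintype ι] [DecidableEq ι] (𝒜 : Finset (Finset ι))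
    {D : ℕ} (hD : 𝒜.vcDim ≤ D) {t : ℝ} (ht : 0 < t) (ht1 : t ≤ 1) :
    (#𝒜 : ℝ) * t ^ D ≤ Real.exp (t * Fintype.card ι) := by
  refine le_trans ?_ (sum_choose_mul_pow_le (Fintype.card ι) D ht ht1)
  gcongr
  have h := (card_le_card_shatterer 𝒜).trans card_shatterer_le_sum_vcDim
  calc (#𝒜 : ℝ) ≤ ∑ k ∈ Iic 𝒜.vcDim, ((Fintype.card ι).choose k : ℝ) := by exact_mod_cast h
    _ ≤ _ := Finset.sum_le_sum_of_subset_of_nonneg (Iic_subset_Iic.2 hD) fun _ _ _ => by positivity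

/-- Random sampling separates the members of a `δ n`-separated family of subsets of an
`n`-point set. -/
theorem exists_injOn_traces {ι : Type*} [Fintype ι] [Nonempty ι] [DecidableEq ι]
    (𝒜 : Finset (Finset ι))
    {δ : ℝ}
    (hsep : ∀ A ∈ 𝒜, ∀ B ∈ 𝒜, A ≠ B → δ * Fintype.card ι ≤ #(symmDiff A B)) (m : ℕ)
    (hm : (#𝒜 : ℝ) ^ 2 * Real.exp (-(δ * m)) < 1) :
    ∃ x : Fin m → ι, Set.InjOn (trace x) (𝒜 : Set (Finset ι)) := by
  by_contra! hcon
  set n := Fintype.card ι with hn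
  have hn0 : (0 : ℝ) < n := by exact_mod_cast Fintype.card_pos
  -- The samples that miss the symmetric difference of the pair: exactly those on which its two
  -- members have the same trace.
  let bad : Finset ι × Finset ι → Finset (Fin m → ι) := fun p =>
    Fintype.piFinset fun _ => (symmDiff p.1 p.2)ᶜ
  have hcover : (univ : Finset (Fin m → ι)) ⊆ 𝒜.offDiag.biUnion bad := by
    intro x _
    have h := hcon x
    simp only [Set.InjOn] at h
    push Not at h
    obtain ⟨A, hA, B, hB, hAB, hne⟩ := h
    refine mem_biUnion.2 ⟨(A, B), mem_offDiag.2 ⟨hA, hB, hne⟩, ?_⟩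
    refine Fintype.mem_piFinset.2 fun k => ?_
    have := Finset.ext_iff.1 hAB k
    simp only [mem_trace] at this
    simp only [mem_compl, mem_symmDiff]
    tauto
  have hbad : ∀ p ∈ 𝒜.offDiag, (#(bad p) : ℝ) ≤ n ^ m * Real.exp (-(δ * m)) := by
    intro p hp
    obtain ⟨hA, hB, hne⟩ := mem_offDiag.1 hp
    have hc : (#(symmDiff p.1 p.2)ᶜ : ℝ) ≤ n * Real.exp (-δ) := by
      have h1 := Finset.card_compl_add_card (symmDiff p.1 p.2)
      have h2 := hsep _ hA _ hB hne
      have h3 : (#(symmDiff p.1 p.2)ᶜ : ℝ) + #(symmDiff p.1 p.2) = n := by exact_mod_cast h1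
      have h4 := Real.add_one_le_exp (-δ)
      nlinarith
    simp only [bad, Fintype.card_piFinset, prod_const, card_univ, Fintype.card_fin, Nat.cast_pow]
    calc ((#(symmDiff p.1 p.2)ᶜ : ℝ)) ^ m ≤ (n * Real.exp (-δ)) ^ m := by gcongr
      _ = _ := by rw [mul_pow, ← Real.exp_nat_mul]; ring_nf
  have h1 : (n : ℝ) ^ m ≤ (#𝒜 : ℝ) ^ 2 * (n ^ m * Real.exp (-(δ * m))) := by
    calc (n : ℝ) ^ m = #(univ : Finset (Fin m → ι)) := by simp [hn]
      _ ≤ #(𝒜.offDiag.biUnion bad) := by exact_mod_cast card_le_card hcover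
      _ ≤ ∑ p ∈ 𝒜.offDiag, (#(bad p) : ℝ) := by exact_mod_cast card_biUnion_le
      _ ≤ ∑ p ∈ 𝒜.offDiag, (n : ℝ) ^ m * Real.exp (-(δ * m)) := Finset.sum_le_sum hbad
      _ = #𝒜.offDiag * ((n : ℝ) ^ m * Real.exp (-(δ * m))) := by simp
      _ ≤ _ := by
        gcongr
        rw [offDiag_card]
        have : #𝒜 * #𝒜 - #𝒜 ≤ #𝒜 ^ 2 := by rw [sq]; omega
        exact_mod_cast this
  have h2 : 0 < (n : ℝ) ^ m := by positivity
  nlinarith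

/-- A packing bound: a `δ n`-separated family, whose traces on samples of size `m` obey the
Sauer–Shelah bound in dimension `D`, has at most `(4 / δ) ^ (2 D) e ^ (1 / 2)` members. -/
theorem log_card_le_of_separated {ι : Type*} [Fintype ι] [Nonempty ι] [DecidableEq ι]
    (𝒜 : Finset (Finset ι))
    (D : ℕ) {δ : ℝ} (hδ : 0 < δ) (hδ1 : δ ≤ 1) (hne : 𝒜.Nonempty)
    (htrace : ∀ (m : ℕ) (x : Fin m → ι) (t : ℝ), 0 < t → t ≤ 1 →
      (#(𝒜.image (trace x)) : ℝ) * t ^ D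
        ≤ Real.exp (t * m))
    (hsep : ∀ A ∈ 𝒜, ∀ B ∈ 𝒜, A ≠ B →
      δ * Fintype.card ι ≤ #(symmDiff A B)) :
    Real.log #𝒜 ≤ 2 * D * Real.log (4 / δ) + 1 / 2 := by
  classical
  set L := Real.log #𝒜 with hL
  have hM : (0 : ℝ) < #𝒜 := by exact_mod_cast hne.card_pos
  have hL0 : 0 ≤ L := Real.log_nonneg (by exact_mod_cast hne.card_pos)
  -- The least sample size with |𝒜|² e^(-δm) < 1, so that some sample separates all members.
  set m := ⌊2 * L / δ⌋₊ + 1 with hm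
  have hm1 : 2 * L < δ * m := by
    have := Nat.lt_floor_add_one (2 * L / δ)
    rw [div_lt_iff₀ hδ] at this
    push_cast [hm]
    linarith
  have hm2 : δ * m ≤ 2 * L + δ := by
    have := Nat.floor_le (a := 2 * L / δ) (by positivity)
    rw [le_div_iff₀ hδ] at this
    push_cast [hm]
    linarith
  obtain ⟨x, hx⟩ := exists_injOn_traces 𝒜 (hsep) m (by
    rw [← Real.exp_log hM, ← hL, ← Real.exp_nat_mul, ← Real.exp_add, Real.exp_lt_one_iff]
    push_cast
    linarith)
  -- With t = δ/4 the exponent tm is at most L/2 + 1/4, and the term L/2 is absorbed on the left.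
  have h := htrace m x (δ / 4) (by positivity) (by linarith)
  rw [card_image_of_injOn (hx)] at h
  have h' := Real.log_le_log (by positivity) h
  rw [Real.log_mul hM.ne' (by positivity), Real.log_exp, Real.log_pow, ← hL] at h'
  have h4 : Real.log (δ / 4) = - Real.log (4 / δ) := by rw [← Real.log_inv, inv_div]
  rw [h4] at h'
  nlinarith

/-- Every family has a maximal separated subfamily. -/
theorem exists_separated_net {α : Type*} (𝒜 : Finset α) (ρ : α → α → ℝ)
    (hsymm : ∀ a b, ρ a b = ρ b a) (hself : ∀ a, ρ a a ≤ 0) {η : ℝ} (hη : 0 ≤ η) :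
    ∃ 𝒩 ⊆ 𝒜, (∀ a ∈ 𝒩, ∀ b ∈ 𝒩, a ≠ b → η < ρ a b) ∧ ∀ a ∈ 𝒜, ∃ b ∈ 𝒩, ρ a b ≤ η := by
  classical
  induction 𝒜 using Finset.induction_on with
  | empty => exact ⟨∅, by simp⟩
  | insert a 𝒜 _ ih =>
    obtain ⟨𝒩, hsub, hsep, hcov⟩ := ih
    by_cases h : ∃ b ∈ 𝒩, ρ a b ≤ η
    · refine ⟨𝒩, hsub.trans (subset_insert _ _), hsep, fun c hc => ?_⟩
      rcases mem_insert.1 hc with rfl | hc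
      · exact h
      · exact hcov c hc
    · push Not at h
      refine ⟨insert a 𝒩, insert_subset_insert _ hsub, ?_, fun c hc => ?_⟩
      · intro b hb c hc hbc
        rcases mem_insert.1 hb with hb | hb <;> rcases mem_insert.1 hc with hc | hc
        · exact absurd (hb.trans hc.symm) hbc
        · rw [hb]; exact h c hc
        · rw [hc, hsymm]; exact h b hb
        · exact hsep b hb c hc hbc
      · rcases mem_insert.1 hc with rfl | hc
        · exact ⟨c, mem_insert_self _ _, (hself c).trans hη⟩
        · obtain ⟨b, hb, hcb⟩ := hcov c hc
          exact ⟨b, mem_insert_of_mem hb, hcb⟩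

/-! ### Hoeffding's inequality and chaining for random signed sums. -/

/-- The number of sign patterns for which a signed sum is large (Hoeffding's inequality). -/
theorem card_signs_le {ι : Type*} [Fintype ι] [DecidableEq ι] (a : ι → ℝ) {s Q : ℝ} (hs : 0 < s)
    (hQ : 0 < Q) (ha : ∑ k, a k ^ 2 ≤ Q) :
    (#{σ : ι → Bool | s < ∑ k, (bif σ k then a k else -a k)} : ℝ) ≤
      2 ^ Fintype.card ι * Real.exp (-(s ^ 2 / (2 * Q))) := by
  -- The minimizer of the Chernoff exponent l²Q/2 - ls.
  set l := s / Q with hl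
  have hl0 : 0 < l := by positivity
  have hsum : ∑ σ : ι → Bool, Real.exp (l * ∑ k, (bif σ k then a k else -a k))
      ≤ 2 ^ Fintype.card ι * Real.exp (l ^ 2 * Q / 2) := by
    calc ∑ σ : ι → Bool, Real.exp (l * ∑ k, (bif σ k then a k else -a k))
        = ∑ σ : ι → Bool, ∏ k, Real.exp (l * (bif σ k then a k else -a k)) := by
          simp_rw [Finset.mul_sum, Real.exp_sum]
      _ = ∏ k, ∑ b : Bool, Real.exp (l * (bif b then a k else -a k)) := by
          rw [Finset.prod_univ_sum, Fintype.piFinset_univ]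
      _ ≤ ∏ k, (2 * Real.exp ((l * a k) ^ 2 / 2)) := by
          refine Finset.prod_le_prod (fun _ _ => by positivity) fun k _ => ?_
          have := Real.cosh_le_exp_half_sq (l * a k)
          rw [Real.cosh_eq] at this
          simp only [Fintype.sum_bool, cond_true, cond_false, mul_neg]
          linarith
      _ = 2 ^ Fintype.card ι * Real.exp (l ^ 2 * (∑ k, a k ^ 2) / 2) := by
          rw [Finset.prod_mul_distrib, ← Real.exp_sum]
          simp only [prod_const, card_univ, Finset.mul_sum, Finset.sum_div, mul_pow]
      _ ≤ _ := by gcongr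
  have hmarkov : (#{σ : ι → Bool | s < ∑ k, (bif σ k then a k else -a k)} : ℝ) * Real.exp (l * s)
      ≤ ∑ σ : ι → Bool, Real.exp (l * ∑ k, (bif σ k then a k else -a k)) := by
    rw [← nsmul_eq_mul]
    refine (Finset.card_nsmul_le_sum _
      (fun σ : ι → Bool => Real.exp (l * ∑ k, (bif σ k then a k else -a k))) _ fun σ hσ => ?_).trans
      (Finset.sum_le_sum_of_subset_of_nonneg (subset_univ _) fun _ _ _ => by positivity)
    simp only [mem_filter, mem_univ, true_and] at hσ
    gcongr
  have h := hmarkov.trans hsum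
  rw [← le_div_iff₀ (Real.exp_pos _), mul_div_assoc, ← Real.exp_sub] at h
  have he : -(s ^ 2 / (2 * Q)) = l ^ 2 * Q / 2 - l * s := by
    rw [hl]
    field_simp
    ring
  rwa [he]

/-- The sum over `A` of the signs coded by `σ`. -/
def signedSum {ι : Type*} (σ : ι → Bool) (A : Finset ι) : ℝ := ∑ k ∈ A, (bif σ k then 1 else -1)

section Chaining

variable {ι : Type*} [Fintype ι] [DecidableEq ι]

theorem signedSum_eq (σ : ι → Bool) (A : Finset ι) :
    signedSum σ A = ∑ k, (bif σ k then (if k ∈ A then 1 else 0) else -(if k ∈ A then 1 else 0)) := by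
  rw [signedSum, ← Finset.sum_subset (subset_univ A) fun k _ hk => by simp [hk]]
  exact Finset.sum_congr rfl fun k hk => by simp [hk]

/-- The difference is a signed sum with coefficients in {-1, 0, 1} supported on the symmetric
difference. The increments are thus sub-Gaussian, with variance the distance used for the nets. -/
theorem card_signedSum_sub_le (A B : Finset ι) {s Q : ℝ} (hs : 0 < s) (hQ : 0 < Q)
    (hAB : (#(symmDiff A B) : ℝ) ≤ Q) :
    (#{σ : ι → Bool | s < signedSum σ A - signedSum σ B} : ℝ) ≤
      2 ^ Fintype.card ι * Real.exp (-(s ^ 2 / (2 * Q))) := by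
  have h := card_signs_le (fun k : ι => (if k ∈ A then 1 else 0) - (if k ∈ B then (1 : ℝ) else 0))
    hs hQ (by
      refine le_trans (le_of_eq ?_) hAB
      rw [Finset.card_eq_sum_ones, Nat.cast_sum,
        ← Finset.sum_subset (subset_univ (symmDiff A B)) fun k _ hk => ?_]
      · refine Finset.sum_congr rfl fun k hk => ?_
        rcases mem_symmDiff.1 hk with h | h <;> simp [h.1, h.2]
      · rw [mem_symmDiff] at hk
        by_cases h1 : k ∈ A <;> by_cases h2 : k ∈ B <;> simp_all)
  convert h using 5 with σ
  rw [signedSum_eq, signedSum_eq, ← Finset.sum_sub_distrib]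
  refine Finset.sum_congr rfl fun k _ => ?_
  cases σ k <;> simp; ring

theorem sum_succ_mul_half_pow_le (J : ℕ) :
    ∑ i ∈ range J, ((i : ℝ) + 1) * (1 / 2) ^ i ≤ 4 := by
  have h : ∑ i ∈ range J, ((i : ℝ) + 1) * (1 / 2) ^ i = 4 - (2 * J + 4) * (1 / 2) ^ J := by
    induction J with
    | zero => simp
    | succ J ih => rw [Finset.sum_range_succ, ih, pow_succ]; push_cast; ring
  rw [h]
  have : (0 : ℝ) ≤ (2 * J + 4) * (1 / 2) ^ J := by positivity
  linarith

/-- Nets of controlled size at the scales `4 ^ (-j)` of a family whose traces obey the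
Sauer–Shelah bound. -/
theorem exists_dyadic_net [Nonempty ι] (𝒜 : Finset (Finset ι)) (h𝒜 : 𝒜.Nonempty)
    {D : ℕ} (hD : 1 ≤ D)
    (htrace : ∀ (m : ℕ) (x : Fin m → ι) (t : ℝ), 0 < t → t ≤ 1 →
      (#(𝒜.image (trace x)) : ℝ) * t ^ D ≤ Real.exp (t * m)) (j : ℕ) :
    ∃ 𝒩 ⊆ 𝒜, (#𝒩 : ℝ) ≤ Real.exp (4 * D * (j + 1)) ∧
      ∀ A ∈ 𝒜, ∃ B ∈ 𝒩, (#(symmDiff A B) : ℝ) ≤ (1 / 4) ^ j * Fintype.card ι := by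
  obtain ⟨𝒩, hsub, hsep, hcov⟩ := exists_separated_net 𝒜
    (fun A B => (#(symmDiff A B) : ℝ)) (fun A B => by rw [symmDiff_comm]) (fun A => by simp)
    (η := (1 / 4) ^ j * Fintype.card ι) (by positivity)
  refine ⟨𝒩, hsub, ?_, hcov⟩
  obtain ⟨A, hA⟩ := h𝒜
  obtain ⟨B, hB, -⟩ := hcov A hA
  have hpos : (0 : ℝ) < #𝒩 := by exact_mod_cast card_pos.2 ⟨B, hB⟩
  rw [← Real.log_le_iff_le_exp hpos]
  have h := log_card_le_of_separated 𝒩 D (δ := (1 / 4) ^ j) (by positivity)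
    (pow_le_one₀ (by norm_num) (by norm_num)) ⟨B, hB⟩
    (fun m x t ht ht1 => le_trans (by gcongr) (htrace m x t ht ht1))
    (fun A hA B hB hne => (hsep A hA B hB hne).le)
  have hlog : Real.log (4 / (1 / 4) ^ j) = (j + 1) * (2 * Real.log 2) := by
    have : (4 : ℝ) / (1 / 4) ^ j = 2 ^ (2 * (j + 1)) := by
      rw [one_div, inv_pow, div_inv_eq_mul, pow_mul]
      norm_num
      ring
    rw [this, Real.log_pow]
    push_cast
    ring
  rw [hlog] at h
  have hl2 := Real.log_two_lt_d9
  -- Since 4 log 2 < 3, the slack up to the constant 4 absorbs the additive 1/2.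
  have h1 : (1 : ℝ) ≤ D * (j + 1) := by
    have : (1 : ℝ) ≤ D := by exact_mod_cast hD
    have : (0 : ℝ) ≤ j := by positivity
    nlinarith
  nlinarith

theorem card_filter_le_add {α : Type*} [Fintype α] {p q r : α → Prop} [DecidablePred p]
    [DecidablePred q] [DecidablePred r] (h : ∀ a, p a → q a ∨ r a) :
    (#{a | p a} : ℝ) ≤ #{a | q a} + #{a | r a} := by
  classical
  have hsub : ({a | p a} : Finset α) ⊆ ({a | q a} : Finset α) ∪ ({a | r a} : Finset α) :=
    fun a ha => by simpa using h a (by simpa using ha)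
  exact_mod_cast (card_le_card hsub).trans (card_union_le _ _)

/-- Chaining: the signed sums over a family whose traces obey the Sauer–Shelah bound in dimension
`D` are uniformly of order `√n (√D + √u)`, but for a proportion `e ^ (-u - 2)` of the signs. -/
theorem card_exists_signedSum_le [Nonempty ι] (𝒜 : Finset (Finset ι)) {D : ℕ} (hD : 1 ≤ D)
    (htrace : ∀ (m : ℕ) (x : Fin m → ι) (t : ℝ), 0 < t → t ≤ 1 →
      (#(𝒜.image (trace x)) : ℝ) * t ^ D ≤ Real.exp (t * m)) {u : ℝ} (hu : 0 ≤ u) :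
    (#{σ : ι → Bool | ∃ A ∈ 𝒜, 32 * √(Fintype.card ι) * (√D + √u) < signedSum σ A} : ℝ) ≤
      2 ^ Fintype.card ι * Real.exp (-u - 2) := by
  rcases 𝒜.eq_empty_or_nonempty with rfl | h𝒜
  · simp
    positivity
  set n := Fintype.card ι with hn
  have hn0 : (0 : ℝ) < n := by exact_mod_cast Fintype.card_pos
  have hD1 : (1 : ℝ) ≤ D := by exact_mod_cast hD
  choose 𝒩 hsub hcard hcov using exists_dyadic_net 𝒜 h𝒜 hD htrace
  set c : ℝ := 8 * √n * (√D + √u) with hc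
  have hc0 : 0 < c := by
    have : 0 < √(D : ℝ) := Real.sqrt_pos.2 (by linarith)
    have := Real.sqrt_nonneg u
    have := Real.sqrt_pos.2 hn0
    positivity
  -- The allowance for link j shrinks like the radius 2^(-j) of the net. Its factor j+1 pays for the
  -- entropy 4D(j+1), and all allowances sum to at most 4c, whence the constant 32.
  set s : ℕ → ℝ := fun j => c * (((j : ℝ) + 1) * (1 / 2) ^ j) with hs
  have hs0 : ∀ j, 0 < s j := fun j => by positivity
  clear_value s
  have hlink : ∀ (j : ℕ) (A B : Finset ι), (#(symmDiff A B) : ℝ) ≤ 4 * (1 / 4) ^ j * n →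
      (#{σ : ι → Bool | s j < signedSum σ A - signedSum σ B} : ℝ) ≤
        2 ^ n * Real.exp (-(8 * (D + u) * (j + 1))) := by
    intro j A B hAB
    refine (card_signedSum_sub_le A B (hs0 j) (by positivity) hAB).trans ?_
    gcongr
    have hj : (0 : ℝ) ≤ j := by positivity
    have h1 : s j ^ 2 / (2 * (4 * (1 / 4) ^ j * n)) = 8 * (√D + √u) ^ 2 * (j + 1) ^ 2 := by
      have h4 : ((1 : ℝ) / 4) ^ j = ((1 / 2) ^ j) ^ 2 := by rw [← pow_mul, mul_comm, pow_mul]; norm_num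
      have h5 : (√n : ℝ) ^ 2 = n := Real.sq_sqrt hn0.le
      have h6 : (0 : ℝ) < (1 / 2) ^ j := by positivity
      rw [h4, div_eq_iff (by positivity)]
      simp only [hs, hc, mul_pow, h5]
      ring
    rw [h1]
    have h2 : (D : ℝ) + u ≤ (√D + √u) ^ 2 := by
      have := Real.sq_sqrt (show (0 : ℝ) ≤ D by linarith)
      have := Real.sq_sqrt hu
      nlinarith [Real.sqrt_nonneg (D : ℝ), Real.sqrt_nonneg u]
    have h3 : (j : ℝ) + 1 ≤ (j + 1) ^ 2 := by nlinarith
    exact mul_le_mul (by linarith) h3 (by positivity) (by positivity)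
  have hunion : ∀ (j : ℕ) (ψ : Finset ι → Finset ι),
      (∀ A ∈ 𝒩 j, (#(symmDiff A (ψ A)) : ℝ) ≤ 4 * (1 / 4) ^ j * n) →
      (#{σ : ι → Bool | ∃ A ∈ 𝒩 j, s j < signedSum σ A - signedSum σ (ψ A)} : ℝ) ≤
        2 ^ n * Real.exp (-u - 2) * (1 / 2) ^ (j + 1) := by
    intro j ψ hψ
    have h1 : ({σ : ι → Bool | ∃ A ∈ 𝒩 j, s j < signedSum σ A - signedSum σ (ψ A)} :
        Finset (ι → Bool)) ⊆ (𝒩 j).biUnion fun A =>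
          {σ : ι → Bool | s j < signedSum σ A - signedSum σ (ψ A)} := by
      intro σ hσ
      simpa using hσ
    calc (#{σ : ι → Bool | ∃ A ∈ 𝒩 j, s j < signedSum σ A - signedSum σ (ψ A)} : ℝ)
        ≤ ∑ A ∈ 𝒩 j, (#{σ : ι → Bool | s j < signedSum σ A - signedSum σ (ψ A)} : ℝ) := by
          exact_mod_cast (card_le_card h1).trans card_biUnion_le
      _ ≤ ∑ A ∈ 𝒩 j, 2 ^ n * Real.exp (-(8 * (D + u) * (j + 1))) :=
          Finset.sum_le_sum fun A hA => hlink j A _ (hψ A hA)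
      _ = 2 ^ n * (#(𝒩 j) * Real.exp (-(8 * (D + u) * (j + 1)))) := by
          rw [sum_const, nsmul_eq_mul]; ring
      _ ≤ 2 ^ n * (Real.exp (4 * D * (j + 1)) * Real.exp (-(8 * (D + u) * (j + 1)))) := by
          gcongr
          exact hcard j
      -- Net size against tail leaves the exponent -(4D+8u)(j+1), and D ≥ 1 lets it beat -u - 2 -
      -- (j+1).
      _ ≤ 2 ^ n * (Real.exp (-u - 2) * Real.exp (-1) ^ (j + 1)) := by
          rw [← Real.exp_nat_mul, ← Real.exp_add, ← Real.exp_add]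
          refine mul_le_mul_of_nonneg_left (Real.exp_le_exp.2 ?_) (by positivity)
          have hj : (0 : ℝ) ≤ j := by positivity
          push_cast
          nlinarith [mul_nonneg hj hu, mul_nonneg hj (sub_nonneg.2 hD1)]
      _ ≤ 2 ^ n * (Real.exp (-u - 2) * (1 / 2) ^ (j + 1)) := by
          gcongr
          have := Real.exp_one_gt_d9
          rw [Real.exp_neg, one_div]
          exact inv_anti₀ (by norm_num) (by linarith)
      _ = _ := by ring
  have hmain : ∀ j : ℕ,
      (#{σ : ι → Bool | ∃ A ∈ 𝒩 j, ∑ i ∈ range (j + 1), s i < signedSum σ A} : ℝ) ≤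
        2 ^ n * Real.exp (-u - 2) * (1 - (1 / 2) ^ (j + 1)) := by
    intro j
    induction j with
    | zero =>
      -- The chain starts from the empty set, whose signed sum vanishes.
      have h := hunion 0 (fun _ => ∅) fun A _ => by
        have : (#A : ℝ) ≤ n := by exact_mod_cast card_le_univ A
        simp [symmDiff_bot, ← Finset.bot_eq_empty]
        linarith
      simp only [signedSum, sum_empty, sub_zero] at h
      simp only [zero_add, sum_range_one, signedSum]
      convert h using 2
      norm_num
    | succ j ih =>
      choose! π hπ hπd using hcov j
      -- A point of net j+1 lies within 4^(-j)n of net j; this is the factor 4 in the radius of a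
      -- link.
      have h := hunion (j + 1) π fun A hA => by
        refine (hπd A (hsub _ hA)).trans (le_of_eq ?_)
        rw [pow_succ]; ring
      have heq : 2 ^ n * Real.exp (-u - 2) * (1 - (1 / 2) ^ (j + 1 + 1)) =
          2 ^ n * Real.exp (-u - 2) * (1 - (1 / 2) ^ (j + 1)) +
            2 ^ n * Real.exp (-u - 2) * (1 / 2) ^ (j + 1 + 1) := by ring
      rw [heq]
      refine (card_filter_le_add fun σ => ?_).trans (add_le_add ih h)
      rintro ⟨A, hA, hσA⟩
      rw [sum_range_succ] at hσA
      by_cases hle : s (j + 1) < signedSum σ A - signedSum σ (π A)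
      · exact Or.inr ⟨A, hA, hle⟩
      · exact Or.inl ⟨π A, hπ A (hsub _ hA), by linarith⟩
  -- Once 4^J > n the radius is below one element, so the net is the whole family and the chain is
  -- finite.
  obtain ⟨J, hJ⟩ := pow_unbounded_of_one_lt (n : ℝ) (show (1 : ℝ) < 4 by norm_num)
  have hss : ({σ : ι → Bool | ∃ A ∈ 𝒜, 32 * √n * (√D + √u) < signedSum σ A} :
      Finset (ι → Bool)) ⊆
      ({σ : ι → Bool | ∃ A ∈ 𝒩 J, ∑ i ∈ range (J + 1), s i < signedSum σ A} :
        Finset (ι → Bool)) := by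
    intro σ hσ
    simp only [mem_filter, mem_univ, true_and] at hσ ⊢
    obtain ⟨A, hA, hσA⟩ := hσ
    obtain ⟨B, hB, hAB⟩ := hcov J A hA
    have hlt : (1 / 4 : ℝ) ^ J * n < 1 := by
      rw [one_div, inv_pow, inv_mul_lt_iff₀ (by positivity)]
      simpa using hJ
    have h0 : #(symmDiff A B) = 0 := by
      have : (#(symmDiff A B) : ℝ) < 1 := hAB.trans_lt hlt
      exact Nat.lt_one_iff.1 (by exact_mod_cast this)
    have hAB' : A = B := by
      rw [card_eq_zero] at h0
      exact symmDiff_eq_bot.1 h0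
    refine ⟨B, hB, lt_of_le_of_lt ?_ (hAB' ▸ hσA)⟩
    have := sum_succ_mul_half_pow_le (J + 1)
    simp only [hs, ← Finset.mul_sum]
    refine (mul_le_mul_of_nonneg_left this hc0.le).trans (le_of_eq ?_)
    rw [hc]; ring
  refine (Nat.cast_le.2 (card_le_card hss)).trans ((hmain J).trans ?_)
  have : (0 : ℝ) ≤ (1 / 2) ^ (J + 1) := by positivity
  exact mul_le_of_le_one_right (by positivity) (by linarith)

end Chaining

/-! ### Symmetrization and the uniform deviation of half-space counts. -/

section Symmetrization

variable {E ι : Type*} [NormedAddCommGroup E] [InnerProductSpace ℝ E] [Fintype ι]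

/-- The number of points `z k` in the half-space `{x | r < ⟪x, v⟫}`. -/
def hits (r : ℝ) (v : E) (z : ι → E) : ℝ :=
  ∑ k, Set.indicator {x : E | r < inner ℝ x v} (fun _ => (1 : ℝ)) (z k)

theorem hits_eq_card (r : ℝ) (v : E) (z : ι → E) :
    hits r v z = #{k | r < inner ℝ (z k) v} := by
  classical
  simp [hits, Set.indicator_apply, Finset.sum_boole]

variable [FiniteDimensional ℝ E]

open scoped Classical in
theorem card_signs_halfspaces_le [Nonempty ι] [DecidableEq ι] (V : Set E) (r : ℝ) (w : ι → E)
    {u : ℝ} (hu : 0 ≤ u) :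
    (#{σ : ι → Bool | ∃ v ∈ V, 32 * √(Fintype.card ι) * (√((finrank ℝ E : ℝ) + 1) + √u) <
        signedSum σ {k | r < inner ℝ (w k) v}} : ℝ) ≤
      2 ^ Fintype.card ι * Real.exp (-u - 2) := by
  have h := card_exists_signedSum_le (halfspaceTraces V r w) (D := finrank ℝ E + 1) (by omega)
    (fun m x t ht ht1 => by
      have h1 := card_mul_pow_vcDim_le (halfspaceTraces V r (w ∘ x))
        (vcDim_halfspaceTraces_le (w ∘ x)) ht ht1
      rw [Fintype.card_fin] at h1
      refine le_trans ?_ h1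
      gcongr
      exact image_subset_iff.2 fun A hA => halfspaceTraces_comp w x hA) hu
  refine le_trans (Nat.cast_le.2 (card_le_card fun σ hσ => ?_)) h
  simp only [mem_filter, mem_univ, true_and] at hσ ⊢
  obtain ⟨v, hv, hσ⟩ := hσ
  exact ⟨_, mem_halfspaceTraces.2 ⟨v, hv, rfl⟩, by push_cast; exact hσ⟩

/-- Under exchange the second sample carries the opposite signs; flipping all signs brings it under
the same bound as the first. -/
theorem card_compl_signs {ι : Type*} [Fintype ι] [DecidableEq ι] (p : (ι → Bool) → Prop)
    [DecidablePred p] :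
    #{σ : ι → Bool | p fun k => !σ k} = #{σ : ι → Bool | p σ} := by
  refine Finset.card_bij (fun σ _ k => !σ k) (fun σ hσ => by simpa using hσ)
    (fun σ _ τ _ h => ?_) fun σ hσ => ⟨fun k => !σ k, by simpa using hσ, by simp⟩
  funext k
  simpa using congrFun h k

open scoped Classical in
/-- Among the exchanges of the points of two samples, only a proportion `2 e ^ (-u - 2)` makes
the counts in some half-space differ by more than the chaining bound. -/
theorem card_swaps_le [Nonempty ι] (V : Set E) (r : ℝ) (p : ι → E × E) {u : ℝ} (hu : 0 ≤ u) :
    (#{σ : ι → Bool | ∃ v ∈ V, 64 * √(Fintype.card ι) * (√((finrank ℝ E : ℝ) + 1) + √u) <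
        hits r v (fun k => (if σ k then p k else (p k).swap).1) -
          hits r v (fun k => (if σ k then p k else (p k).swap).2)} : ℝ) ≤
      2 ^ Fintype.card ι * (2 * Real.exp (-u - 2)) := by
  set τ := 32 * √(Fintype.card ι) * (√((finrank ℝ E : ℝ) + 1) + √u) with hτ
  have h1 := card_signs_halfspaces_le V r (fun k => (p k).1) hu
  have h2 := card_signs_halfspaces_le V r (fun k => (p k).2) hu
  rw [← card_compl_signs] at h2
  refine (card_filter_le_add fun σ => ?_).trans ((add_le_add h1 h2).trans (le_of_eq (by ring)))
  rintro ⟨v, hv, hlt⟩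
  have heq : hits r v (fun k => (if σ k then p k else (p k).swap).1) -
      hits r v (fun k => (if σ k then p k else (p k).swap).2) =
      signedSum σ {k | r < inner ℝ (p k).1 v} +
        signedSum (fun k => !σ k) {k | r < inner ℝ (p k).2 v} := by
    rw [signedSum_eq, signedSum_eq, hits, hits, ← Finset.sum_sub_distrib, ← Finset.sum_add_distrib]
    refine Finset.sum_congr rfl fun k _ => ?_
    cases σ k <;> simp [Set.indicator_apply] <;> ring
  rw [heq] at hlt
  by_cases hle : τ < signedSum σ {k | r < inner ℝ (p k).1 v}
  · exact Or.inl ⟨v, hv, hle⟩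
  · refine Or.inr ⟨v, hv, ?_⟩
    linarith

theorem measurePreserving_swaps {E : Type*} [MeasurableSpace E] (ν : Measure E)
    [IsProbabilityMeasure ν] (σ : ι → Bool) :
    MeasurePreserving (fun (p : ι → E × E) k => if σ k then p k else (p k).swap)
      (Measure.pi fun _ => ν.prod ν) (Measure.pi fun _ => ν.prod ν) := by
  refine measurePreserving_pi _ _ (f := fun k (q : E × E) => if σ k then q else q.swap) fun k => ?_
  cases σ k
  · simpa using Measure.measurePreserving_swap
  · simpa using! MeasurePreserving.id (ν.prod ν)

variable [MeasurableSpace E] [BorelSpace E]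

theorem measurableSet_halfspace (r : ℝ) (v : E) : MeasurableSet {x : E | r < inner ℝ x v} :=
  measurableSet_lt measurable_const (by fun_prop)

theorem measurable_hits (r : ℝ) (v : E) : Measurable (hits r v : (ι → E) → ℝ) :=
  Finset.measurable_sum _ fun k _ =>
    (measurable_const.indicator (measurableSet_halfspace r v)).comp (measurable_pi_apply k)

variable (ν : Measure E) [IsProbabilityMeasure ν]

/-- The symmetrized deviation bound for two independent samples. -/
theorem measure_exists_hits_sub_le [Nonempty ι] {V : Set E} (hV : V.Countable) (r : ℝ) {u : ℝ}
    (hu : 0 ≤ u) :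
    ((Measure.pi fun _ : ι => ν).prod (Measure.pi fun _ : ι => ν))
      {q | ∃ v ∈ V, 64 * √(Fintype.card ι) * (√((finrank ℝ E : ℝ) + 1) + √u) <
        hits r v q.1 - hits r v q.2} ≤ ENNReal.ofReal (2 * Real.exp (-u - 2)) := by
  classical
  set τ := 64 * √(Fintype.card ι) * (√((finrank ℝ E : ℝ) + 1) + √u) with hτ
  set W : Set ((ι → E) × (ι → E)) := {q | ∃ v ∈ V, τ < hits r v q.1 - hits r v q.2} with hW
  have hWm : MeasurableSet W := by
    have : W = ⋃ v ∈ V, {q | τ < hits r v q.1 - hits r v q.2} := by ext; simp [hW]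
    rw [this]
    exact MeasurableSet.biUnion hV fun v _ => measurableSet_lt measurable_const
      (((measurable_hits r v).comp measurable_fst).sub ((measurable_hits r v).comp measurable_snd))
  have hmp := measurePreserving_arrowProdEquivProdArrow E E ι (fun _ => ν) (fun _ => ν)
  rw [← hmp.measure_preimage hWm.nullMeasurableSet]
  set Q := Measure.pi fun _ : ι => ν.prod ν with hQ
  set W' := MeasurableEquiv.arrowProdEquivProdArrow E E ι ⁻¹' W with hW'
  have hW'm : MeasurableSet W' := hmp.measurable hWm
  let T : (ι → Bool) → (ι → E × E) → (ι → E × E) :=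
    fun σ p k => if σ k then p k else (p k).swap
  have hT : ∀ σ, MeasurePreserving (T σ) Q Q := measurePreserving_swaps ν
  -- Every exchange preserves `Q`, so the measure of `W'` is its average over all exchanges.
  -- Swapping sum and integral reduces it to counting exchanges for fixed points.
  have hsum : (2 : ENNReal) ^ Fintype.card ι * Q W' ≤
      2 ^ Fintype.card ι * ENNReal.ofReal (2 * Real.exp (-u - 2)) := by
    calc (2 : ENNReal) ^ Fintype.card ι * Q W' = ∑ σ : ι → Bool, Q (T σ ⁻¹' W') := by
          simp [(hT _).measure_preimage hW'm.nullMeasurableSet]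
      _ = ∑ σ : ι → Bool, ∫⁻ p, (T σ ⁻¹' W').indicator 1 p ∂Q := by
          refine Finset.sum_congr rfl fun σ _ => ?_
          rw [lintegral_indicator_one ((hT σ).measurable hW'm)]
      _ = ∫⁻ p, ∑ σ : ι → Bool, (T σ ⁻¹' W').indicator 1 p ∂Q := by
          rw [lintegral_finsetSum]
          exact fun σ _ => measurable_one.indicator ((hT σ).measurable hW'm)
      _ ≤ ∫⁻ _, 2 ^ Fintype.card ι * ENNReal.ofReal (2 * Real.exp (-u - 2)) ∂Q := by
          refine lintegral_mono fun p => ?_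
          have h := ENNReal.ofReal_le_ofReal (card_swaps_le V r p hu)
          rw [ENNReal.ofReal_natCast, ENNReal.ofReal_mul (by positivity),
            ENNReal.ofReal_pow (by norm_num), ENNReal.ofReal_ofNat] at h
          refine le_trans (le_of_eq ?_) h
          simp only [Set.indicator_apply, Pi.one_apply, Finset.sum_boole]
          rfl
      _ = _ := by simp
  exact (ENNReal.mul_le_mul_iff_right (by simp) (by simp)).1 hsum

/-- Chebyshev's inequality for the count of a half-space. -/
theorem half_le_measure_hits_le (r : ℝ) (v : E) {τ : ℝ} (hτ : 0 < τ)
    (hτ2 : (Fintype.card ι : ℝ) ≤ τ ^ 2) :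
    2⁻¹ ≤ (Measure.pi fun _ : ι => ν)
      {z | hits r v z ≤ Fintype.card ι * ν.real {x | r < inner ℝ x v} + τ} := by
  set H : Set E := {x : E | r < inner ℝ x v} with hH
  have hHm : MeasurableSet H := measurableSet_halfspace r v
  set f : E → ℝ := H.indicator fun _ => (1 : ℝ) with hf
  have hfL : MemLp f 2 ν := memLp_indicator_const 2 hHm 1 (by simp)
  have hint : ∫ x, f x ∂ν = ν.real H := by
    rw [hf, integral_indicator_const _ hHm]; simp
  have hvar : Var[f; ν] ≤ 1 / 4 := by
    refine (variance_le_sq_of_bounded (a := 0) (b := 1) (ae_of_all _ fun x => ?_)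
      hfL.aestronglyMeasurable.aemeasurable).trans (by norm_num)
    by_cases hx : x ∈ H <;> simp [hf, hx]
  have heq : (hits r v : (ι → E) → ℝ) = ∑ k : ι, fun z : ι → E => f (z k) := by
    funext z; simp [hits, hf, hH]
  have hL : MemLp (hits r v : (ι → E) → ℝ) 2 (Measure.pi fun _ : ι => ν) := by
    rw [heq]
    exact memLp_finsetSum' _ fun k _ =>
      hfL.comp_measurePreserving (measurePreserving_eval (fun _ : ι => ν) k)
  have hmean : ∫ z, hits r v z ∂(Measure.pi fun _ : ι => ν) = Fintype.card ι * ν.real H := by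
    simp only [hits]
    rw [integral_finsetSum]
    · have : ∀ k : ι, ∫ z : ι → E, f (z k) ∂(Measure.pi fun _ : ι => ν) = ν.real H := fun k => by
        rw [← hint]
        exact integral_comp_eval (μ := fun _ : ι => ν) hfL.aestronglyMeasurable
      simp only [hf, hH] at this
      simp [this, hH]
    · exact fun k _ => (hfL.comp_measurePreserving
        (measurePreserving_eval (fun _ : ι => ν) k)).integrable (by norm_num)
  have hv : Var[(hits r v : (ι → E) → ℝ); Measure.pi fun _ : ι => ν] ≤ Fintype.card ι / 4 := by
    rw [heq, variance_sum_pi (fun _ => hfL)]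
    simp only [sum_const, card_univ, nsmul_eq_mul]
    have : (0 : ℝ) ≤ Fintype.card ι := by positivity
    nlinarith
  have hcheb := meas_ge_le_variance_div_sq hL hτ
  rw [hmean] at hcheb
  have hbound : (Measure.pi fun _ : ι => ν)
      {z | hits r v z ≤ Fintype.card ι * ν.real H + τ}ᶜ ≤ 2⁻¹ := by
    refine (measure_mono fun z hz => ?_).trans (hcheb.trans ?_)
    · simp only [Set.mem_compl_iff, Set.mem_ofPred_eq, not_le] at hz ⊢
      exact le_trans (by linarith) (le_abs_self _)
    · rw [← ENNReal.ofReal_ofNat 2, ← ENNReal.ofReal_inv_of_pos (by norm_num)]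
      refine ENNReal.ofReal_le_ofReal ?_
      rw [div_le_iff₀ (by positivity)]
      nlinarith
  have hm : MeasurableSet {z : ι → E | hits r v z ≤ Fintype.card ι * ν.real H + τ} :=
    measurableSet_le (measurable_hits r v) measurable_const
  rw [prob_compl_eq_one_sub hm, tsub_le_iff_right] at hbound
  have h2 : (1 : ENNReal) = 2⁻¹ + 2⁻¹ := (ENNReal.inv_two_add_inv_two).symm
  rw [h2] at hbound
  exact (ENNReal.add_le_add_iff_left (by simp)).1 hbound

/-- The uniform deviation inequality for half-spaces at a fixed level `r` and with directions in a
countable set `V`. -/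
theorem measure_exists_hits_le [Nonempty ι] {V : Set E} (hV : V.Countable) (r : ℝ) {u : ℝ}
    (hu : 0 ≤ u) :
    (Measure.pi fun _ : ι => ν)
      {z | ∃ v ∈ V, Fintype.card ι * ν.real {x | r < inner ℝ x v} +
        128 * √(Fintype.card ι) * (√((finrank ℝ E : ℝ) + 1) + √u) < hits r v z} ≤
      ENNReal.ofReal (Real.exp (-u)) := by
  set P := Measure.pi fun _ : ι => ν with hP
  set τ := 64 * √(Fintype.card ι) * (√((finrank ℝ E : ℝ) + 1) + √u) with hτ
  have hn : (0 : ℝ) < Fintype.card ι := by exact_mod_cast Fintype.card_pos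
  have h1 : (1 : ℝ) ≤ √((finrank ℝ E : ℝ) + 1) + √u := by
    have : (1 : ℝ) ≤ √((finrank ℝ E : ℝ) + 1) := Real.one_le_sqrt.2 (by
      have : (0 : ℝ) ≤ finrank ℝ E := by positivity
      linarith)
    have := Real.sqrt_nonneg u
    linarith
  have hs := Real.sqrt_pos.2 hn
  have hsq := Real.sq_sqrt hn.le
  have hle : √(Fintype.card ι : ℝ) ≤ τ := by
    rw [hτ]; nlinarith
  have hτ0 : 0 < τ := hs.trans_le hle
  have hτ2 : (Fintype.card ι : ℝ) ≤ τ ^ 2 := by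
    rw [← hsq]; gcongr
  set A : Set (ι → E) := {z | ∃ v ∈ V, Fintype.card ι * ν.real {x | r < inner ℝ x v} +
        128 * √(Fintype.card ι) * (√((finrank ℝ E : ℝ) + 1) + √u) < hits r v z} with hA
  set W : Set ((ι → E) × (ι → E)) := {q | ∃ v ∈ V, τ < hits r v q.1 - hits r v q.2} with hW
  have hAm : MeasurableSet A := by
    have : A = ⋃ v ∈ V, {z | Fintype.card ι * ν.real {x | r < inner ℝ x v} +
        128 * √(Fintype.card ι) * (√((finrank ℝ E : ℝ) + 1) + √u) < hits r v z} := by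
      ext; simp [hA]
    rw [this]
    exact MeasurableSet.biUnion hV fun v _ => measurableSet_lt measurable_const (measurable_hits r v)
  have hWm : MeasurableSet W := by
    have : W = ⋃ v ∈ V, {q | τ < hits r v q.1 - hits r v q.2} := by ext; simp [hW]
    rw [this]
    exact MeasurableSet.biUnion hV fun v _ => measurableSet_lt measurable_const
      (((measurable_hits r v).comp measurable_fst).sub ((measurable_hits r v).comp measurable_snd))
  have hsym := measure_exists_hits_sub_le (ι := ι) ν hV r hu
  -- For fixed z ∈ A with witness v, an independent second sample stays within τ of its mean with
  -- probability at least 1/2, and then the two counts differ by more than 2τ - τ. This is why 128 =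
  -- 2 · 64.
  have hlow : 2⁻¹ * P A ≤ (P.prod P) W := by
    rw [Measure.prod_apply hWm, ← lintegral_indicator_const hAm]
    refine lintegral_mono fun z => ?_
    by_cases hz : z ∈ A
    · rw [Set.indicator_of_mem hz]
      obtain ⟨v, hv, hzv⟩ := hz
      refine (half_le_measure_hits_le ν r v hτ0 hτ2).trans (measure_mono fun z' hz' => ?_)
      refine ⟨v, hv, ?_⟩
      simp only [Set.mem_ofPred_eq] at hz'
      simp only
      linarith
    · simp [hz]
  have h4 : P A ≤ 2 * ENNReal.ofReal (2 * Real.exp (-u - 2)) := by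
    have h := mul_le_mul_right (hlow.trans hsym) 2
    rwa [← mul_assoc, ENNReal.mul_inv_cancel (by simp) (by simp), one_mul] at h
  refine h4.trans ?_
  rw [← ENNReal.ofReal_ofNat 2, ← ENNReal.ofReal_mul (by norm_num)]
  refine ENNReal.ofReal_le_ofReal ?_
  have he : Real.exp (-u) = Real.exp (-u - 2) * Real.exp 1 ^ 2 := by
    rw [← Real.exp_nat_mul, ← Real.exp_add]; norm_num
  have h5 := Real.exp_one_gt_d9
  -- The -2 kept in the chaining exponent pays for two factors 2: the two samples and the
  -- conditional probability 1/2.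
  have h6 : (4 : ℝ) ≤ Real.exp 1 ^ 2 := by nlinarith
  rw [he]
  change (2 : ℝ) * _ ≤ _
  nlinarith [Real.exp_pos (-u - 2)]

end Symmetrization

/-! ### The law of the block sums. -/

section BlockLaw

variable {Ω : Type*} [MeasurableSpace Ω] {P : Measure Ω}

/-- Disjoint blocks of i.i.d. variables form an i.i.d. family. -/
theorem map_blocks_eq_pi {E κ ι γ : Type*} [MeasurableSpace E] [Fintype κ] [Fintype ι]
    {Y : γ → Ω → E} (hm : ∀ i, Measurable (Y i)) (hindep : iIndepFun Y P) {𝓛 : Measure E}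
    [IsProbabilityMeasure 𝓛] (hlaw : ∀ i, P.map (Y i) = 𝓛) {φ : κ × ι → γ}
    (hφ : Function.Injective φ) :
    P.map (fun ω k j => Y (φ (k, j)) ω) =
      Measure.pi fun _ : κ => Measure.pi fun _ : ι => 𝓛 := by
  have h1 : P.map (fun ω p => Y (φ p) ω) = Measure.pi fun _ : κ × ι => 𝓛 := by
    rw [(hindep.precomp hφ).map_fun_eq_pi_map fun p => (hm (φ p)).aemeasurable]
    simp [hlaw]
  have h2 := Measure.infinitePi_map_curry fun (_ : κ) (_ : ι) => 𝓛
  simp only [Measure.infinitePi_eq_pi] at h2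
  rw [← h2, ← h1, Measure.map_map (by fun_prop) (by fun_prop)]
  rfl

theorem map_family_eq_pi {E ι γ : Type*} [MeasurableSpace E] [Fintype ι]
    {Y : γ → Ω → E} (hm : ∀ i, Measurable (Y i)) (hindep : iIndepFun Y P) {𝓛 : Measure E}
    (hlaw : ∀ i, P.map (Y i) = 𝓛) {φ : ι → γ} (hφ : Function.Injective φ) :
    P.map (fun ω j => Y (φ j) ω) = Measure.pi fun _ : ι => 𝓛 := by
  rw [(hindep.precomp hφ).map_fun_eq_pi_map fun p => (hm (φ p)).aemeasurable]
  simp [hlaw]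

variable {d N K : ℕ}

theorem IsEqualSizePartition.card_eq {N K : ℕ} [NeZero K] {B : Fin K → Finset (Fin N)}
    (hB : IsEqualSizePartition B) (k : Fin K) : #(B k) = N / K := by
  exact (Nat.div_eq_of_eq_mul_left (NeZero.pos K) (hB.2 k).symm).symm

theorem IsEqualSizePartition.div_mul_eq [NeZero K] {B : Fin K → Finset (Fin N)}
    (hB : IsEqualSizePartition B) : N / K * K = N := by
  rw [← hB.card_eq ⟨0, NeZero.pos K⟩]
  exact hB.2 _

/-- The normalized, centred sums over the blocks. -/
def blockSum (μ : EuclideanSpace ℝ (Fin d)) (c : ℝ) (x : Fin N → EuclideanSpace ℝ (Fin d))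
    (b : Finset (Fin N)) : EuclideanSpace ℝ (Fin d) :=
  c • ∑ i ∈ b, (x i - μ)

/-- The normalized block sums are i.i.d., with the tails given by `tailH`. -/
theorem exists_law_blockSum [IsProbabilityMeasure P] [NeZero K] {B : Fin K → Finset (Fin N)} (hKN : K ≤ N)
    (hB : IsEqualSizePartition B) {Y : Fin N → Ω → EuclideanSpace ℝ (Fin d)} (hY : IsIID P Y)
    (μ : EuclideanSpace ℝ (Fin d)) :
    ∃ ν : Measure (EuclideanSpace ℝ (Fin d)), IsProbabilityMeasure ν ∧
      P.map (fun ω k => blockSum μ (1 / √((N : ℝ) / K)) (fun i => Y i ω) (B k)) =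
        (Measure.pi fun _ : Fin K => ν) ∧
      ∀ v r, ν.real {x | r < inner ℝ x v} = tailH P Y μ K v r := by
  have hK := NeZero.pos K
  let i₀ : Fin N := ⟨0, by omega⟩
  set 𝓛 := P.map (Y i₀) with h𝓛
  have : IsProbabilityMeasure 𝓛 := Measure.isProbabilityMeasure_map (hY.measurable i₀).aemeasurable
  have hlaw : ∀ i, P.map (Y i) = 𝓛 := fun i => (hY.identDistrib i i₀).map_eq
  set m := N / K with hm
  set c := 1 / √((N : ℝ) / K) with hc
  let G : (Fin m → EuclideanSpace ℝ (Fin d)) → EuclideanSpace ℝ (Fin d) :=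
    fun y => c • ∑ j, (y j - μ)
  have hG : Measurable G := by fun_prop
  have hpi : ∀ k, #(B k) = m := hB.card_eq
  -- Each block is enumerated increasingly. Disjointness makes this injective, so all block sums are
  -- the same function `G` of separate groups of i.i.d. vectors.
  let φ : Fin K × Fin m → Fin N := fun p => (B p.1).orderEmbOfFin (hpi p.1) p.2
  have hφ : Function.Injective φ := by
    rintro ⟨k, j⟩ ⟨k', j'⟩ h
    have h1 := (B k).orderEmbOfFin_mem (hpi k) j
    have h2 := (B k').orderEmbOfFin_mem (hpi k') j'
    change (B k).orderEmbOfFin (hpi k) j = (B k').orderEmbOfFin (hpi k') j' at h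
    rw [← h] at h2
    obtain rfl := (hB.1 _).unique h1 h2
    rw [(orderEmbOfFin (B k) (hpi k)).injective h]
  have hmN : m ≤ N := Nat.div_le_self _ _
  refine ⟨(Measure.pi fun _ : Fin m => 𝓛).map G, Measure.isProbabilityMeasure_map hG.aemeasurable,
    ?_, fun v r => ?_⟩
  · have h1 := map_blocks_eq_pi hY.measurable hY.indep hlaw hφ
    have h2 := (measurePreserving_pi (fun _ : Fin K => Measure.pi fun _ : Fin m => 𝓛)
      (fun _ : Fin K => (Measure.pi fun _ : Fin m => 𝓛).map G) (f := fun _ => G)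
      fun _ => ⟨hG, rfl⟩)
    rw [← h2.map_eq, ← h1, Measure.map_map h2.measurable
      (measurable_pi_lambda _ fun k => measurable_pi_lambda _ fun j => hY.measurable _)]
    congr 1
    funext ω k
    simp only [blockSum, Function.comp, G, φ]
    congr 1
    conv_lhs => rw [← map_orderEmbOfFin_univ (B k) (hpi k)]
    rw [sum_map]
    rfl
  · have h1 := map_family_eq_pi hY.measurable hY.indep hlaw (Fin.castLE_injective hmN)
    rw [← h1, Measure.map_map hG (measurable_pi_lambda _ fun j => hY.measurable _),
      measureReal_def, Measure.map_apply
        (hG.comp (measurable_pi_lambda _ fun j => hY.measurable _)) (measurableSet_halfspace r v),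
      tailH, measureReal_def]
    congr 2
    ext ω
    have hfil : univ.filter (fun i : Fin N => (i : ℕ) < N / K) =
        univ.map (Fin.castLEEmb hmN) := by
      ext i
      simp only [mem_filter, mem_univ, true_and, mem_map]
      exact ⟨fun h => ⟨⟨i, h⟩, rfl⟩, by rintro ⟨j, rfl⟩; exact j.2⟩
    simp only [Set.mem_preimage, Set.mem_ofPred_eq, Function.comp, G, hfil, sum_map,
      inner_smul_left, sum_inner]
    rfl

end BlockLaw

/-! ### Medians and minimizers of the Fenchel transform. -/

section Median

variable {K : ℕ} [NeZero K]

/-- Negation reverses the sorted order, which exchanges the two middle indices (K-1)/2 and K/2.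
Averaging both is what makes the median odd. -/
theorem med_neg (a : Fin K → ℝ) : (med fun k => -a k) = -med a := by
  have h : (fun k => -a k) ∘ Tuple.sort (fun k => -a k) =
      (fun k => -a k) ∘ (Fin.revPerm.trans (Tuple.sort a)) := by
    refine Tuple.unique_monotone (Tuple.monotone_sort _) fun i j hij => ?_
    have := Tuple.monotone_sort a (Fin.rev_le_rev.2 hij)
    simpa using this
  have hK := NeZero.pos K
  unfold med
  rw [h]
  have h1 : Fin.rev (⟨(K - 1) / 2, by omega⟩ : Fin K) = ⟨K / 2, by omega⟩ := by
    ext; simp only [Fin.val_rev]; omega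
  have h2 : Fin.rev (⟨K / 2, by omega⟩ : Fin K) = ⟨(K - 1) / 2, by omega⟩ := by
    ext; simp only [Fin.val_rev]; omega
  simp only [Function.comp, Equiv.trans_apply, Fin.revPerm_apply, h1, h2]
  ring

/-- The median is at most `c` when less than half of the entries exceed `c`. -/
theorem med_le {a : Fin K → ℝ} {c : ℝ} (h : 2 * #{k | c < a k} < K) : med a ≤ c := by
  have hK := NeZero.pos K
  have hmono := Tuple.monotone_sort a
  -- Otherwise all K - K/2 ≥ K/2 sorted entries from this index on would exceed c.
  have hhi : (a ∘ Tuple.sort a) ⟨K / 2, by omega⟩ ≤ c := by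
    by_contra! hlt
    have hsub : (Ici (⟨K / 2, by omega⟩ : Fin K)).map (Tuple.sort a).toEmbedding ⊆
        ({k | c < a k} : Finset (Fin K)) := by
      intro k hk
      obtain ⟨i, hi, rfl⟩ := mem_map.1 hk
      simpa using hlt.trans_le (hmono (mem_Ici.1 hi))
    have hcard := card_le_card hsub
    rw [card_map, Fin.card_Ici] at hcard
    simp only at hcard
    omega
  have hlo : (a ∘ Tuple.sort a) ⟨(K - 1) / 2, by omega⟩ ≤ c :=
    (hmono (Fin.mk_le_mk.2 (by omega))).trans hhi
  unfold med
  linarith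

variable {d : ℕ}

theorem medFun_neg (x : Fin K → EuclideanSpace ℝ (Fin d)) (v : EuclideanSpace ℝ (Fin d)) :
    medFun x (-v) = -medFun x v := by
  simp only [medFun, inner_neg_right, med_neg]

theorem medFun_single (x : Fin K → EuclideanSpace ℝ (Fin d)) (j : Fin d) :
    medFun x (EuclideanSpace.single j 1) = coordMed x j := by
  simp [medFun, coordMed, EuclideanSpace.inner_single_right]

/-- On the signed basis, the function `g` is the linear form given by the coordinate-wise median. -/
theorem medFun_eq_inner (x : Fin K → EuclideanSpace ℝ (Fin d)) {v : EuclideanSpace ℝ (Fin d)}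
    (hv : v ∈ signedBasis d) : medFun x v = inner ℝ (coordMed x) v := by
  obtain ⟨j, rfl | rfl⟩ := hv
  · simp [medFun_single, EuclideanSpace.inner_single_right]
  · simp [medFun_neg, medFun_single, EuclideanSpace.inner_single_right]

theorem neg_mem_signedBasis {v : EuclideanSpace ℝ (Fin d)} (hv : v ∈ signedBasis d) :
    -v ∈ signedBasis d := by
  obtain ⟨j, rfl | rfl⟩ := hv
  · exact ⟨j, Or.inr rfl⟩
  · exact ⟨j, Or.inl (neg_neg _)⟩

theorem le_fenchel {S : Set (EuclideanSpace ℝ (Fin d))} {f : EuclideanSpace ℝ (Fin d) → ℝ}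
    (μ : EuclideanSpace ℝ (Fin d)) {v : EuclideanSpace ℝ (Fin d)} (hv : v ∈ S) :
    ((inner ℝ μ v - f v : ℝ) : EReal) ≤ fenchel S f μ :=
  le_iSup₂ (f := fun v (_ : v ∈ S) => ((inner ℝ μ v - f v : ℝ) : EReal)) v hv

/-- On the signed basis g is the linear form of the coordinate-wise median m, so the objective is
the supremum of ⟨μ - m, v⟩ over a symmetric set that detects every coordinate. -/
theorem argmin_fenchel_signedBasis (x : Fin K → EuclideanSpace ℝ (Fin d)) :
    argmin (fenchel (signedBasis d) (medFun x)) = {coordMed x} := by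
  -- Only an inequality: for d = 0 the signed basis is empty and the supremum is `⊥`.
  have hzero : fenchel (signedBasis d) (medFun x) (coordMed x) ≤ 0 :=
    iSup₂_le fun v hv => by rw [medFun_eq_inner x hv, sub_self]; exact le_rfl
  ext μ
  rw [Set.mem_singleton_iff]
  constructor
  · intro hμ
    ext j
    have h0 := (hμ (coordMed x)).trans hzero
    have key : ∀ v ∈ signedBasis d, inner ℝ μ v ≤ inner ℝ (coordMed x) v := fun v hv => by
      have h := (le_fenchel μ hv).trans h0
      rw [medFun_eq_inner x hv] at h
      have h' : inner ℝ μ v - inner ℝ (coordMed x) v ≤ (0 : ℝ) := by exact_mod_cast h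
      linarith
    have h1 := key _ ⟨j, Or.inl rfl⟩
    have h2 := key _ ⟨j, Or.inr rfl⟩
    simp only [inner_neg_right, EuclideanSpace.inner_single_right] at h1 h2
    simp at h1 h2
    exact le_antisymm h1 h2
  · rintro rfl ν
    refine iSup₂_le fun v hv => ?_
    rw [medFun_eq_inner x hv, sub_self]
    rcases le_total 0 (inner ℝ ν v - inner ℝ (coordMed x) v : ℝ) with h | h
    · refine le_trans ?_ (le_fenchel ν hv)
      rw [medFun_eq_inner x hv]
      exact_mod_cast h
    · refine le_trans ?_ (le_fenchel ν (neg_mem_signedBasis hv))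
      rw [medFun_eq_inner x (neg_mem_signedBasis hv), inner_neg_right, inner_neg_right]
      have : (0 : ℝ) ≤ -inner ℝ ν v - -inner ℝ (coordMed x) v := by linarith
      exact_mod_cast this

/-- A minimizer of `g_S^*` is within `2ρ` of `μ` if `g` is within `ρ` of `⟪μ, ·⟫` on `S`. -/
theorem pseudoNorm_sub_le {S : Set (EuclideanSpace ℝ (Fin d))}
    {g : EuclideanSpace ℝ (Fin d) → ℝ} {μ : EuclideanSpace ℝ (Fin d)} {ρ : ℝ}
    (hg : ∀ v ∈ S, |g v - inner ℝ μ v| ≤ ρ) {μhat : EuclideanSpace ℝ (Fin d)}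
    (hμhat : μhat ∈ argmin (fenchel S g)) :
    pseudoNorm S (μhat - μ) ≤ ((2 * ρ : ℝ) : EReal) := by
  refine iSup₂_le fun v hv => ?_
  -- By minimality the bound ρ passes to `μhat`, so ⟨μhat, v⟩ ≤ g(v) + ρ ≤ ⟨μ, v⟩ + 2ρ.
  have h1 : fenchel S g μ ≤ (ρ : EReal) := iSup₂_le fun w hw => by
    have := (abs_le.1 (hg w hw)).1
    exact EReal.coe_le_coe_iff.2 (by linarith)
  have h2 := (le_fenchel μhat hv).trans ((hμhat μ).trans h1)
  have h3 := EReal.coe_le_coe_iff.1 h2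
  have h4 := (abs_le.1 (hg v hv)).2
  rw [real_inner_comm, inner_sub_left]
  exact EReal.coe_le_coe_iff.2 (by linarith)

end Median

/-! ### From counts of block sums to medians of corrupted bucketed means. -/

/-- A bound on the counts in open half-spaces with directions in a dense subset of `S` extends
to `S`. -/
theorem hits_le_of_subset_closure {E ι : Type*} [NormedAddCommGroup E] [InnerProductSpace ℝ E]
    [Fintype ι] {V S : Set E} (hVS : S ⊆ closure V) {r a : ℝ} {z : ι → E}
    (h : ∀ v ∈ V, hits r v z ≤ a) {v : E} (hv : v ∈ S) : hits r v z ≤ a := by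
  set s : Set ι := {k | r < inner ℝ (z k) v} with hs
  -- Finitely many strict inequalities persist for nearby directions: the count is lower
  -- semicontinuous in v.
  have hopen : IsOpen (⋂ k ∈ s, {w : E | r < inner ℝ (z k) w}) :=
    s.toFinite.isOpen_biInter fun k _ => isOpen_lt continuous_const (by fun_prop)
  obtain ⟨w, hw, hwV⟩ := mem_closure_iff.1 (hVS hv) _ hopen (by simp [hs])
  refine le_trans ?_ (h w hwV)
  refine Finset.sum_le_sum fun k _ => ?_
  simp only [Set.mem_iInter] at hw
  by_cases hk : r < inner ℝ (z k) v
  · have := hw k hk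
    simp only [Set.mem_ofPred_eq] at this
    simp [hk, this]
  · simp only [Set.indicator_apply, Set.mem_ofPred_eq, hk, if_false]
    split_ifs <;> norm_num

variable {d N K : ℕ}

/-- At most one block per corrupted index is affected by the corruption. -/
theorem card_bucketMean_le {B : Fin K → Finset (Fin N)} (hB : IsEqualSizePartition B)
    {x y : Fin N → EuclideanSpace ℝ (Fin d)} {O : Finset (Fin N)} (hO : ∀ i ∉ O, x i = y i)
    (v : EuclideanSpace ℝ (Fin d)) (c : ℝ) :
    #{k | c < inner ℝ (bucketMean x (B k)) v} ≤ #{k | c < inner ℝ (bucketMean y (B k)) v} + #O := by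
  choose β hβ hβu using hB.1
  have hsub : ({k | c < inner ℝ (bucketMean x (B k)) v} : Finset (Fin K)) ⊆
      ({k | c < inner ℝ (bucketMean y (B k)) v} : Finset (Fin K)) ∪ O.image β := by
    intro k hk
    rw [mem_union]
    by_cases h : ∃ i ∈ O, i ∈ B k
    · obtain ⟨i, hi, hik⟩ := h
      exact Or.inr (mem_image.2 ⟨i, hi, (hβu i k hik).symm⟩)
    · push Not at h
      refine Or.inl ?_
      have : bucketMean x (B k) = bucketMean y (B k) := by
        unfold bucketMean
        rw [Finset.sum_congr rfl fun i hi => hO i fun hiO => h i hiO hi]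
      simpa [this] using hk
  exact (card_le_card hsub).trans ((card_union_le _ _).trans (by gcongr; exact card_image_le))

theorem blockSum_eq_smul_bucketMean (μ : EuclideanSpace ℝ (Fin d))
    (x : Fin N → EuclideanSpace ℝ (Fin d)) {b : Finset (Fin N)} (hb : 0 < #b) :
    blockSum μ (1 / √(#b : ℝ)) x b = √(#b : ℝ) • (bucketMean x b - μ) := by
  have hb' : (0 : ℝ) < #b := by exact_mod_cast hb
  have hs := Real.sqrt_pos.2 hb'
  have hsq := Real.mul_self_sqrt hb'.le
  have h1 : √(#b : ℝ) * (#b : ℝ)⁻¹ = 1 / √(#b : ℝ) := by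
    field_simp
    rw [sq, hsq]
  have h2 : √(#b : ℝ) = 1 / √(#b : ℝ) * #b := by
    field_simp
    rw [sq, hsq]
  rw [blockSum, bucketMean, sum_sub_distrib, sum_const, smul_sub, smul_sub, smul_smul, h1,
    ← Nat.cast_smul_eq_nsmul ℝ, smul_smul, ← h2]

theorem inner_bucketMean_gt_iff (μ v : EuclideanSpace ℝ (Fin d))
    (x : Fin N → EuclideanSpace ℝ (Fin d)) {b : Finset (Fin N)} (hb : 0 < #b) (r : ℝ) :
    r / √(#b : ℝ) + inner ℝ μ v < inner ℝ (bucketMean x b) v ↔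
      r < inner ℝ (blockSum μ (1 / √(#b : ℝ)) x b) v := by
  have hs : 0 < √(#b : ℝ) := Real.sqrt_pos.2 (by exact_mod_cast hb)
  rw [blockSum_eq_smul_bucketMean μ x hb, inner_smul_left, inner_sub_left, ← lt_sub_iff_add_lt,
    div_lt_iff₀ hs, mul_comm]
  simp

/-- Identifies the rate with the level r of the normalized block sums, brought back to the scale of
the means by 1/√m. -/
theorem rate_eq_div_sqrt (C c₁ : ℝ) (d o : ℕ) (u : ℝ) {N K m : ℕ} (hN : m * K = N) (hK : 0 < K) :
    rate C c₁ d N K o u =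
      ((C * (√(((d : ℝ) + 1) / K) + √(u / K)) + o / K) / c₁) / √(m : ℝ) := by
  subst hN
  have hK' : (0 : ℝ) < K := by exact_mod_cast hK
  have h1 : √((K : ℝ) * (m * K : ℕ)) = K * √(m : ℝ) := by
    push_cast
    rw [show (K : ℝ) * (m * K) = K ^ 2 * m by ring, Real.sqrt_mul (by positivity),
      Real.sqrt_sq hK'.le]
  have h2 : ∀ a : ℝ, √(a / (m * K : ℕ)) = √(a / K) / √(m : ℝ) := fun a => by
    push_cast
    rw [← Real.sqrt_div' _ (by positivity), div_div, mul_comm (K : ℝ)]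
  rw [rate, h1, h2, h2]
  simp only [div_eq_mul_inv, mul_inv]
  ring

/-- With probability at least `1 - e ^ (-u)`, the medians of the corrupted bucketed means are
uniformly close to `⟪μ, v⟫` in the directions `v ∈ S`. -/
theorem exists_event_abs_medFun_sub_le {Ω : Type*} [MeasurableSpace Ω] (P : Measure Ω)
    [IsProbabilityMeasure P] {o : ℕ} [NeZero K] (hKN : K ≤ N)
    {B : Fin K → Finset (Fin N)} (hB : IsEqualSizePartition B)
    {S : Set (EuclideanSpace ℝ (Fin d))} (hS : ∀ v ∈ S, -v ∈ S)
    {Y X : Fin N → Ω → EuclideanSpace ℝ (Fin d)} (hY : IsIID P Y) (hX : IsCorruption o Y X)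
    {μ : EuclideanSpace ℝ (Fin d)} {c₀ c₁ : ℝ} (hc₁ : 0 < c₁)
    (hreg : IsRegularAtZero P Y μ K S c₀ c₁) {u : ℝ} (hu : 0 ≤ u)
    (hsmall : 129 * (√(((d : ℝ) + 1) / K) + √(u / K)) + (o : ℝ) / K ≤ c₀ * c₁) :
    ∃ E : Set Ω, MeasurableSet E ∧ 1 - Real.exp (-u) ≤ P.real E ∧
      ∀ ω ∈ E, ∀ v ∈ S,
        |medFun (fun k => bucketMean (fun i => X i ω) (B k)) v - inner ℝ μ v| ≤
          rate 129 c₁ d N K o u := by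
  have hK := NeZero.pos K
  have hK' : (0 : ℝ) < K := by exact_mod_cast hK
  set m := N / K with hm
  have hmK : m * K = N := hB.div_mul_eq
  have hm0 : 0 < m := Nat.div_pos hKN hK
  have hcard : ∀ k, #(B k) = m := hB.card_eq
  have hNK : (N : ℝ) / K = m := by rw [← hmK]; push_cast; field_simp
  set T := √(((d : ℝ) + 1) / K) + √(u / K) with hT
  have hT0 : 0 < T := by
    have : 0 < √(((d : ℝ) + 1) / K) := Real.sqrt_pos.2 (by positivity)
    have := Real.sqrt_nonneg (u / K)
    linarith
  have hKT : √(K : ℝ) * (√((d : ℝ) + 1) + √u) = K * T := by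
    rw [hT, Real.sqrt_div' _ hK'.le, Real.sqrt_div' _ hK'.le]
    have h1 := Real.mul_self_sqrt hK'.le
    have h2 := Real.sqrt_pos.2 hK'
    nth_rw 2 [← h1]
    field_simp
  -- This makes Kc₁r = 129KT + o, covering the deviation 128KT and the o corrupted blocks. The spare
  -- KT > 0 gives the strict inequality required by `med_le`. The smallness assumption is exactly r
  -- ≤ c₀.
  set r := (129 * T + o / K) / c₁ with hr
  have hr0 : 0 < r := by positivity
  have hrc : r ≤ c₀ := by rwa [hr, div_le_iff₀ hc₁]
  have hrate : rate 129 c₁ d N K o u = r / √(m : ℝ) := rate_eq_div_sqrt 129 c₁ d o u hmK hK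
  -- A countable dense set of directions keeps the exceptional event measurable.
  obtain ⟨V, hVS, hVc, hSV⟩ :=
    (TopologicalSpace.IsSeparable.of_separableSpace S).exists_countable_dense_subset
  obtain ⟨ν, hν, hlaw, htail⟩ := exists_law_blockSum hKN hB hY μ
  rw [hNK] at hlaw
  set Z : Ω → Fin K → EuclideanSpace ℝ (Fin d) :=
    fun ω k => blockSum μ (1 / √(m : ℝ)) (fun i => Y i ω) (B k) with hZ
  have hZm : Measurable Z := by
    have := hY.measurable
    unfold Z blockSum
    fun_prop
  have hdev := measure_exists_hits_le (ι := Fin K) ν hVc r hu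
  set A : Set (Fin K → EuclideanSpace ℝ (Fin d)) := {z | ∃ v ∈ V,
    Fintype.card (Fin K) * ν.real {x | r < inner ℝ x v} + 128 * √(Fintype.card (Fin K)) *
      (√((finrank ℝ (EuclideanSpace ℝ (Fin d)) : ℝ) + 1) + √u) < hits r v z} with hA
  have hAm : MeasurableSet A := by
    have : A = ⋃ v ∈ V, {z | Fintype.card (Fin K) * ν.real {x | r < inner ℝ x v} +
        128 * √(Fintype.card (Fin K)) *
          (√((finrank ℝ (EuclideanSpace ℝ (Fin d)) : ℝ) + 1) + √u) < hits r v z} := by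
      ext; simp [hA]
    rw [this]
    exact MeasurableSet.biUnion hVc fun v _ => measurableSet_lt measurable_const (measurable_hits r v)
  rw [← hlaw, Measure.map_apply hZm hAm] at hdev
  -- The event depends on the inliers alone; the corruption is treated pointwise on it, so it may
  -- depend on the data arbitrarily.
  refine ⟨(Z ⁻¹' A)ᶜ, (hZm hAm).compl, ?_, fun ω hω => ?_⟩
  · rw [probReal_compl_eq_one_sub (hZm hAm)]
    have := ENNReal.toReal_le_of_le_ofReal (Real.exp_pos _).le hdev
    rw [← measureReal_def] at this
    linarith
  have hcount : ∀ v ∈ S, hits r v (Z ω) ≤ K * (1 / 2 - c₁ * r) + 128 * (K * T) := by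
    refine fun v hv => hits_le_of_subset_closure hSV (fun w hw => ?_) hv
    have h1 : ¬ ∃ v ∈ V, _ < hits r v (Z ω) := hω
    push Not at h1
    have h2 := h1 w hw
    have h3 := hreg w (hVS hw) r hr0 hrc
    rw [htail, Fintype.card_fin, finrank_euclideanSpace_fin, mul_assoc, hKT] at h2
    have := mul_le_mul_of_nonneg_left h3 hK'.le
    linarith
  have hmed : ∀ v ∈ S, medFun (fun k => bucketMean (fun i => X i ω) (B k)) v ≤
      r / √(m : ℝ) + inner ℝ μ v := by
    intro v hv
    refine med_le ?_
    obtain ⟨O, hOcard, hO⟩ := hX ω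
    have h1 := card_bucketMean_le hB hO v (r / √(m : ℝ) + inner ℝ μ v)
    have h2 : (#{k | r / √(m : ℝ) + inner ℝ μ v <
        inner ℝ (bucketMean (fun i => Y i ω) (B k)) v} : ℝ) = hits r v (Z ω) := by
      rw [hits_eq_card]
      congr 3
      ext k
      have := inner_bucketMean_gt_iff μ v (fun i => Y i ω) (b := B k) (by rw [hcard]; exact hm0) r
      rw [hcard] at this
      exact this
    have h3 := hcount v hv
    have h4 : (K : ℝ) * (c₁ * r) = 129 * (K * T) + o := by
      rw [hr]; field_simp
    have h5 : 0 < K * T := by positivity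
    have h6 : (#{k | r / √(m : ℝ) + inner ℝ μ v <
        inner ℝ (bucketMean (fun i => X i ω) (B k)) v} : ℝ) ≤ hits r v (Z ω) + o := by
      rw [← h2]
      exact_mod_cast h1.trans (by gcongr)
    have h7 : (2 : ℝ) * #{k | r / √(m : ℝ) + inner ℝ μ v <
        inner ℝ (bucketMean (fun i => X i ω) (B k)) v} < K := by linarith
    exact_mod_cast h7
  intro v hv
  rw [hrate, abs_le]
  have h1 := hmed v hv
  have h2 := hmed (-v) (hS v hv)
  rw [medFun_neg, inner_neg_right] at h2
  constructor <;> linarith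

/-! ### The Cauchy location model. -/

/-- The derivative 1/(1+x²) is at least 1/2 on [0, 1]. Divided by π, this slope is the constant c₁ =
1/(2π). -/
theorem half_le_arctan {r : ℝ} (hr0 : 0 ≤ r) (hr1 : r ≤ 1) : r / 2 ≤ Real.arctan r := by
  have h := (convex_Icc (0 : ℝ) 1).mul_sub_le_image_sub_of_le_deriv (f := Real.arctan) (C := 1 / 2)
    Real.continuous_arctan.continuousOn Real.differentiable_arctan.differentiableOn
    (fun x hx => by
      rw [interior_Icc] at hx
      rw [Real.deriv_arctan, div_le_div_iff_of_pos_left] <;> nlinarith [hx.1, hx.2])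
    0 (by simp) r ⟨hr0, hr1⟩ hr0
  simp at h
  linarith

theorem cauchyMeasure_real_eq {s : Set ℝ} (hs : MeasurableSet s) :
    (cauchyMeasure 0 1).real s = Real.pi⁻¹ * ∫ x in s, (1 + x ^ 2)⁻¹ := by
  rw [cauchyMeasure_of_scale_ne_zero _ one_ne_zero, measureReal_def, withDensity_apply _ hs]
  simp only [cauchyPDF_def]
  rw [← integral_eq_lintegral_of_nonneg_ae
    (ae_of_all _ fun x => (cauchyPDF_pos 0 one_ne_zero x).le)
    (stronglyMeasurable_cauchyPDFReal 0 1).aestronglyMeasurable, ← integral_const_mul]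
  refine integral_congr_ae (ae_of_all _ fun x => ?_)
  simp [cauchyPDFReal_def, add_comm]

/-- The tails of the standard Cauchy distribution near `0`. -/
theorem cauchyMeasure_real_tails_le {r : ℝ} (hr0 : 0 ≤ r) (hr1 : r ≤ 1) :
    (cauchyMeasure 0 1).real (Set.Ioi r) ≤ 1 / 2 - 1 / (2 * Real.pi) * r ∧
      (cauchyMeasure 0 1).real (Set.Iic (-r)) ≤ 1 / 2 - 1 / (2 * Real.pi) * r := by
  have hpi := Real.pi_pos
  have h : Real.pi⁻¹ * (Real.pi / 2 - Real.arctan r) ≤ 1 / 2 - 1 / (2 * Real.pi) * r := by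
    have := half_le_arctan hr0 hr1
    field_simp
    linarith
  rw [cauchyMeasure_real_eq measurableSet_Ioi, cauchyMeasure_real_eq measurableSet_Iic,
    integral_Ioi_inv_one_add_sq, integral_Iic_inv_one_add_sq, Real.arctan_neg]
  exact ⟨h, le_trans (le_of_eq (by ring)) h⟩

/-- The Cauchy location model is regular at `0` in the directions of the signed basis. -/
theorem isRegularAtZero_of_cauchy {Ω : Type*} [MeasurableSpace Ω] (P : Measure Ω)
    [IsProbabilityMeasure P] [NeZero N] {Y : Fin N → Ω → EuclideanSpace ℝ (Fin d)}
    (hY : ∀ i, Measurable (Y i)) {μ : EuclideanSpace ℝ (Fin d)}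
    (hcauchy : ∀ i j, P.map (fun ω => Y i ω j - μ j) = cauchyMeasure 0 1) :
    IsRegularAtZero P Y μ N (signedBasis d) 1 (1 / (2 * Real.pi)) := by
  have hN := NeZero.pos N
  have hfil : univ.filter (fun i : Fin N => (i : ℕ) < N / N) = {⟨0, hN⟩} := by
    rw [Nat.div_self hN]
    ext i
    simp only [mem_filter, mem_univ, true_and, mem_singleton, Fin.ext_iff]
    omega
  have hmeas : ∀ j, Measurable fun ω => Y ⟨0, hN⟩ ω j - μ j := fun j => by
    have := hY ⟨0, hN⟩
    fun_prop
  rintro v ⟨j, rfl | rfl⟩ r hr0 hr1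
  · refine le_trans (le_of_eq ?_) (cauchyMeasure_real_tails_le hr0.le hr1).1
    rw [← hcauchy ⟨0, hN⟩ j, map_measureReal_apply (hmeas j) measurableSet_Ioi, tailH]
    congr 1
    ext ω
    simp [hfil, EuclideanSpace.inner_single_right]
  · refine le_trans ?_ (cauchyMeasure_real_tails_le hr0.le hr1).2
    rw [← hcauchy ⟨0, hN⟩ j, map_measureReal_apply (hmeas j) measurableSet_Iic, tailH]
    refine measureReal_mono fun ω hω => ?_
    simp [hfil, EuclideanSpace.inner_single_right] at hω
    simp
    linarith

theorem isEqualSizePartition_singleton (N : ℕ) :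
    IsEqualSizePartition fun i : Fin N => ({i} : Finset (Fin N)) :=
  ⟨fun i => ⟨i, by simp, fun k hk => by simpa using (mem_singleton.1 hk).symm⟩, by simp⟩

theorem bucketMean_singleton (x : Fin N → EuclideanSpace ℝ (Fin d)) (i : Fin N) :
    bucketMean x {i} = x i := by
  simp [bucketMean]

theorem rate_mono_left {C C' c₁ : ℝ} (hC : C ≤ C') (hc₁ : 0 < c₁) (d N K o : ℕ) (u : ℝ) :
    rate C c₁ d N K o u ≤ rate C' c₁ d N K o u := by
  unfold rate
  gcongr

end RobustLocation

end

/-! ### Assembly and choice of the constant. -/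

open RobustLocation in
theorem theorem6 :
    ∃ C₀ : ℝ, 0 < C₀ ∧
      -- the bound for every minimizer of `g_S^*`, for all symmetric `S`
      (∀ {Ω : Type*} [MeasurableSpace Ω] (P : Measure Ω) [IsProbabilityMeasure P]
        (d N K o : ℕ) [NeZero K], K ≤ N →
        ∀ B : Fin K → Finset (Fin N), RobustLocation.IsEqualSizePartition B →
        ∀ S : Set (EuclideanSpace ℝ (Fin d)), (∀ v ∈ S, -v ∈ S) →
        ∀ Y X : Fin N → Ω → EuclideanSpace ℝ (Fin d),
        RobustLocation.IsIID P Y → RobustLocation.IsCorruption o Y X →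
        ∀ (μ : EuclideanSpace ℝ (Fin d)) (c₀ c₁ : ℝ), 0 < c₀ → 0 < c₁ →
        RobustLocation.IsRegularAtZero P Y μ K S c₀ c₁ →
        ∀ u : ℝ, 0 < u →
        C₀ * (√(((d : ℝ) + 1) / K) + √(u / K)) + (o : ℝ) / K ≤ c₀ * c₁ →
        ∃ E : Set Ω, MeasurableSet E ∧ 1 - Real.exp (-u) ≤ P.real E ∧
          ∀ ω ∈ E, ∀ μhat ∈ RobustLocation.argmin (RobustLocation.fenchel S
              (RobustLocation.medFun fun k => RobustLocation.bucketMean (fun i => X i ω) (B k))),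
            RobustLocation.pseudoNorm S (μhat - μ) ≤
              ((2 * RobustLocation.rate C₀ c₁ d N K o u : ℝ) : EReal)) ∧
      -- for `S = {± e_j}` the estimator is the coordinate-wise median (of the bucketed means)
      (∀ (d K : ℕ) [NeZero K] (x : Fin K → EuclideanSpace ℝ (Fin d)),
        RobustLocation.argmin (RobustLocation.fenchel (RobustLocation.signedBasis d)
          (RobustLocation.medFun x)) = {RobustLocation.coordMed x}) ∧
      -- the coordinate-wise median of the data in the Cauchy location model
      (∀ {Ω : Type*} [MeasurableSpace Ω] (P : Measure Ω) [IsProbabilityMeasure P]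
        (d N o : ℕ) [NeZero N] (Y X : Fin N → Ω → EuclideanSpace ℝ (Fin d)),
        RobustLocation.IsIID P Y → RobustLocation.IsCorruption o Y X →
        ∀ μ : EuclideanSpace ℝ (Fin d),
        (∀ i j, P.map (fun ω => Y i ω j - μ j) = cauchyMeasure 0 1) →
        ∀ u : ℝ, 0 < u →
        C₀ * (√(((d : ℝ) + 1) / N) + √(u / N)) + (o : ℝ) / N ≤ 1 / (2 * Real.pi) →
        ∃ E : Set Ω, MeasurableSet E ∧ 1 - Real.exp (-u) ≤ P.real E ∧
          ∀ ω ∈ E, ‖fun j => RobustLocation.coordMed (fun i => X i ω) j - μ j‖ ≤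
            2 * C₀ * (√(((d : ℝ) + 1) / N) + √(u / N)) + 2 * Real.pi * o / N) := by
  -- 516 = 4 · 129: the Cauchy bound must absorb 129 · 2π into 2C₀, and π ≤ 4.
  refine ⟨516, by norm_num, ?_, ?_, ?_⟩
  · intro Ω _ P _ d N K o _ hKN B hB S hS Y X hY hX μ c₀ c₁ _ hc₁ hreg u hu hsmall
    have hT : 0 ≤ √(((d : ℝ) + 1) / K) + √(u / K) := by positivity
    obtain ⟨E, hEm, hEP, hE⟩ := exists_event_abs_medFun_sub_le P hKN hB hS hY hX hc₁ hreg hu.le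
      (by linarith)
    exact ⟨E, hEm, hEP, fun ω hω μhat hμhat => pseudoNorm_sub_le (fun v hv => (hE ω hω v hv).trans
      (rate_mono_left (by norm_num) hc₁ d N K o u)) hμhat⟩
  · intro d K _ x
    exact argmin_fenchel_signedBasis x
  · intro Ω _ P _ d N o _ Y X hY hX μ hcauchy u hu hsmall
    have hN : (0 : ℝ) < N := by exact_mod_cast NeZero.pos N
    have hpi := Real.pi_pos
    set T := √(((d : ℝ) + 1) / N) + √(u / N) with hT
    have hT0 : 0 ≤ T := by positivity
    obtain ⟨E, hEm, hEP, hE⟩ := exists_event_abs_medFun_sub_le P le_rfl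
      (isEqualSizePartition_singleton N) (fun v hv => neg_mem_signedBasis hv) hY hX
      (by positivity) (isRegularAtZero_of_cauchy P hY.measurable hcauchy) hu.le (by linarith)
    refine ⟨E, hEm, hEP, fun ω hω => ?_⟩
    have hrate : rate 129 (1 / (2 * Real.pi)) d N N o u ≤ 2 * 516 * T + 2 * Real.pi * o / N := by
      have h1 : rate 129 (1 / (2 * Real.pi)) d N N o u =
          129 * (2 * Real.pi) * T + 2 * Real.pi * o / N := by
        rw [rate, Real.sqrt_mul_self hN.le, ← hT]
        field_simp
      rw [h1]
      have h2 : 129 * (2 * Real.pi) * T ≤ 2 * 516 * T :=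
        mul_le_mul_of_nonneg_right (by linarith [Real.pi_le_four]) hT0
      linarith
    refine (pi_norm_le_iff_of_nonneg (by positivity)).2 fun j => ?_
    -- The deviation of g at e_j is already the error of coordinate j. Going through the minimizer
    -- bound would double the outlier term to 4πo/N.
    have h := hE ω hω (EuclideanSpace.single j 1) ⟨j, Or.inl rfl⟩
    simp only [bucketMean_singleton, medFun_single] at h
    rw [EuclideanSpace.inner_single_right] at h
    simp only [one_mul, conj_trivial] at h
    exact h.trans hrate
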